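/- **Setting.** A dynamic deterministic MDP (Dd-MDP) has a finite state set $\mathcal S$, a finite action set $\mathcal X$, a set $X_s\subseteq\mathcal X$ of feasible actions for each $s\in\mathcal S$, and an initial state $s_1$. It is played for $T$ rounds. In round $t$ the decision maker, being in state $s_t$, plays a (random) action $x_t\in X_{s_t}$, while the adversary selects a transition function $g_t$ and a reward function $f_t$, which map each pair $(s,x)$ with $x\in X_s$ to a state, respectively to a number in $[0,1]$. The decision maker obtains $f_t(s_t,x_t)$ and moves to $s_{t+1}=g_t(s_t,x_t)$. Under full-information feedback she then observes $g_t$ and $f_t$; under bandit feedback she observes $g_t$ and the number $f_t(s_t,x_t)$ only. A policy $\gamma$ assigns to each state $s$ an action in $X_s$; its simulation is $s_1^\gamma=s_1$, $x_t^\gamma=\gamma(s_t^\gamma)$, $s_{t+1}^\gamma=g_t(s_t^\gamma,x_t^\gamma)$. The regret with respect to a finite nonempty set $\Gamma$ of policies is $$\max_{\gamma\in\Gamma}\sum_{t=1}^T f_t(s_t^\gamma,x_t^\gamma)-\sum_{t=1}^T\mathbb E[f_t(s_t,x_t)].$$ Let $\mathcal E$ be the family of sequences $(g_t,f_t)_{t\ge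 1}$ that the adversary may select, obliviously. A chasing oracle is invoked with a target policy $\gamma\in\Gamma$ at the beginning of a round $t_{\rm init}$ in an arbitrary state $s_{\rm init}$. From then on it plays online (possibly at random): its action in round $t$ is feasible for its current state $\hat s(t)$ and is based on what it has seen in the rounds $t_{\rm init},\dots,t-1$. The Dd-MDP is $1$-chasable if there is one chasing oracle such that, for every sequence in $\mathcal E$, every $\gamma\in\Gamma$, all $1\le t_{\rm init}\le t_{\rm final}\le T$ and every $s_{\rm init}\in\mathcal S$, $$\sum_{t=t_{\rm init}}^{t_{\rm final}} f_t(s_t^\gamma,x_t^\gamma)-\sum_{t=t_{\rm init}}^{t_{\rm final}}\mathbb E\big[f_t(\hat s(t),\hat x(t))\big]\le 1,$$ where $\hat x(t)$ is the action of the oracle in round $t$. In the full-information setting the oracle observes $g_t$ and $f_t$ after each round $t$; in the bandit setting it observes only $g_t$ and the number $f_t(\hat s(t),\hat x(t))$. **Theorem.** There is a universal constant $c>0$ such that the following hold. 1. (Full information.) For all integers $K\ge 2$ and $T\ge\log K$ there are a Dd-MDP, a policy collection $\Gamma$ with $|\Gamma|=K$ and a family $\mathcal E$ that are $1$-chasable,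 such that for every randomized online learning algorithm with full-information feedback some sequence in $\mathcal E$ makes its $T$-round regret at least $c\sqrt{T\log|\Gamma|}$. 2. (Bandit feedback.) For all integers $K\ge 2$ and $T\ge K$ there are a Dd-MDP, a policy collection $\Gamma$ with $|\Gamma|=K$ and a family $\mathcal E$ that are $1$-chasable by an oracle that itself uses bandit feedback only, such that for every randomized online learning algorithm with bandit feedback some sequence in $\mathcal E$ makes its $T$-round regret at least $c\,|\Gamma|^{1/3}T^{2/3}$. -/

import Mathlib

/-- The static data of a dynamic deterministic MDP (Dd-MDP): the set of feasible actions of each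
state and the initial state. -/
structure DdMDP (S X : Type) where
  feasible : S → Finset X
  init : S

namespace DdMDP

variable {S X : Type}

/-- The feasible actions of the state `s`. -/
abbrev Act (M : DdMDP S X) (s : S) : Type := {x : X // x ∈ M.feasible s}

/-- What the adversary selects in one round: a state transition function and a reward function
with values in `[0, 1]`, both defined on the pairs (state, feasible action). -/
structure Round (M : DdMDP S X) where
  next : (s : S) → M.Act s → S
  reward : (s : S) → M.Act s → ℝ
  reward_mem : ∀ s x, reward s x ∈ Set.Icc (0 : ℝ) 1

/-- A sequence of choices of the (oblivious) adversary. Rounds are numbered from `0`, so that a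
`T`-round game consists of the rounds `0, …, T - 1`. -/
abbrev Env (M : DdMDP S X) : Type := ℕ → M.Round

/-- A feasible policy. -/
abbrev Policy (M : DdMDP S X) : Type := (s : S) → M.Act s

/-- The state at the beginning of round `t` in the simulation of the policy `γ`. -/
def policyState (M : DdMDP S X) (e : M.Env) (γ : M.Policy) : ℕ → S
  | 0 => M.init
  | t + 1 => (e t).next (M.policyState e γ t) (γ (M.policyState e γ t))

/-- The reward of round `t` in the simulation of the policy `γ`. -/
def policyReward (M : DdMDP S X) (e : M.Env) (γ : M.Policy) (t : ℕ) : ℝ :=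
  (e t).reward (M.policyState e γ t) (γ (M.policyState e γ t))

/-- The record of a round that has been played, under full information: the state and the action
of the player, and the transition and reward functions that the adversary selected. -/
structure Play (M : DdMDP S X) where
  state : S
  action : M.Act state
  round : M.Round

/-- The part of such a record that is visible under bandit feedback: the whole transition function,
but only the realized reward. -/
structure BanditPlay (M : DdMDP S X) where
  state : S
  action : M.Act state
  next : (s : S) → M.Act s → S
  realized : ℝ

/-- The bandit feedback of a round. -/
def Play.toBandit {M : DdMDP S X} (p : M.Play) : M.BanditPlay where
  state := p.state
  action := p.action
  next := p.round.next
  realized := p.round.reward p.state p.action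

/-- A randomized online player: the records of the rounds that it has played so far (latest first)
and the current state determine the law of its next action, a feasible one. -/
abbrev Player (M : DdMDP S X) : Type := List M.Play → (s : S) → PMF (M.Act s)

/-- The player bases its decisions on nothing but bandit feedback. -/
def UsesBanditFeedback {M : DdMDP S X} (A : M.Player) : Prop :=
  ∀ h h' : List M.Play, h.map Play.toBandit = h'.map Play.toBandit → A h = A h'

/-- The expected total reward of the player `A` in the `n` rounds `t, …, t + n - 1`, if it is in
the state `s` at the beginning of round `t` and has the records `h` of its earlier rounds. -/
noncomputable def expectedReward (M : DdMDP S X) (e : M.Env) (A : M.Player) :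
    (n t : ℕ) → List M.Play → S → ℝ
  | 0, _, _, _ => 0
  | n + 1, t, h, s => ∑ x : M.Act s, (A h s x).toReal *
      ((e t).reward s x +
        M.expectedReward e A n (t + 1) (⟨s, x, e t⟩ :: h) ((e t).next s x))

/-- The regret of the online learning algorithm `A` with respect to the policy collection `Γ` in
the `T`-round game against `e`. -/
noncomputable def regret (M : DdMDP S X) (Γ : Finset M.Policy) (hΓ : Γ.Nonempty) (T : ℕ)
    (e : M.Env) (A : M.Player) : ℝ :=
  Γ.sup' hΓ (fun γ => ∑ t ∈ Finset.range T, M.policyReward e γ t)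
    - M.expectedReward e A T 0 [] M.init

/-- An ongoing chasing oracle. Invoked with a target policy at the beginning of a round `t₀`, it
acts as an online player from that round on. The records that it sees start at round `t₀`, and it
learns its initial state as the current state of its first decision. -/
abbrev ChasingOracle (M : DdMDP S X) : Type := M.Policy → (t₀ : ℕ) → M.Player

/-- The chasing regret of the oracle `O` that is invoked with the target policy `γ` at the beginning
of round `t₀`, starts in the state `s₀`, and is halted after the `n` rounds `t₀, …, t₀ + n - 1`. -/
noncomputable def chasingRegret (M : DdMDP S X) (e : M.Env) (O : M.ChasingOracle) (γ : M.Policy)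
    (t₀ n : ℕ) (s₀ : S) : ℝ :=
  ∑ t ∈ Finset.Ico t₀ (t₀ + n), M.policyReward e γ t
    - M.expectedReward e (O γ t₀) n t₀ [] s₀

/-- In `T`-round games the oracle `O` has chasing regret at most `σ`, whichever sequence of the
family `𝓔` the adversary selects, for all target policies, invocation and halting rounds, and
initial states. -/
def ChasesWithin (M : DdMDP S X) (Γ : Finset M.Policy) (T : ℕ) (𝓔 : Set M.Env)
    (O : M.ChasingOracle) (σ : ℝ) : Prop :=
  ∀ e ∈ 𝓔, ∀ γ ∈ Γ, ∀ t₀ n : ℕ, t₀ + n ≤ T → ∀ s₀ : S, M.chasingRegret e O γ t₀ n s₀ ≤ σ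

/-- The `T`-round Dd-MDP in which the adversary may select the sequences of the family `𝓔` is
`σ`-chasable: one online oracle chases within `σ` against all of them. For a one-element family this
is a condition on a single instance. -/
def IsChasable (M : DdMDP S X) (Γ : Finset M.Policy) (T : ℕ) (𝓔 : Set M.Env) (σ : ℝ) : Prop :=
  ∃ O : M.ChasingOracle, M.ChasesWithin Γ T 𝓔 O σ

/-- The same, by an oracle that is applicable to the bandit setting. -/
def IsBanditChasable (M : DdMDP S X) (Γ : Finset M.Policy) (T : ℕ) (𝓔 : Set M.Env) (σ : ℝ) :
    Prop :=
  ∃ O : M.ChasingOracle, (∀ γ t₀, UsesBanditFeedback (O γ t₀)) ∧ M.ChasesWithin Γ T 𝓔 O σ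

end DdMDP

/-! Both bounds use the same kind of game. States and actions are `K` arms, the arm in use can be
changed only in rounds divisible by `τ`, and in each round the rewards of two arms differ by at most
`1 / τ`. An oracle that keeps playing the target's action uses the target's arm from the next
multiple of `τ` on. Before that it loses at most `1 / τ` in each of at most `τ` rounds, so its
chasing regret is at most `1` (`locked_chasesWithin`). The policies are the `K` constant ones.

Full information: take `τ = 1`, which is prediction with expert advice. Each round rewards the arms
that predict a fair coin, so every algorithm earns `T / 2` in expectation. The arms realize all
strings of `m ≈ log₂ K` bits, and bit `j` predicts the rounds congruent to `j` modulo `m`. Some arm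
guesses the majority in every class; by Khinchine's inequality it gains order `√(T / m)` in each
class, in total order `√(T m)`.

Bandit feedback: take `τ ≈ (T / K)^(1/3)`. Each block of `τ` rounds draws one uniform level in `{0,
…, τ}` for all arms, and a hidden good arm is sometimes one level higher. Sharing the noise keeps
the realized differences at most `1 / τ`, but a player who sees only her own arm cannot exploit
this: the law of what she sees changes by a divergence of order `1 / τ²` per block on the good arm,
while its mean advantage is of order `1 / τ`. Since `T / τ` blocks are at most `K τ²`, some good arm
is used in at most `3 T / 4` rounds in expectation (`exists_levelValue_le`), which costs order `T /
τ`, that is, `K^(1/3) T^(2/3)`.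

In both cases a random adversary is replaced by one fixed sequence with at least the average regret
(`exists_iterAvg_le`). -/

namespace DdMDP

/-! ### Iterated averages over the coordinates of a noise sequence -/

section IterAvg

variable {Z : Type} [Fintype Z]

/-- The average of `F` over the coordinates `t, …, t + n - 1` of the noise sequence, drawn
independently with weights `P`; the other coordinates are those of `ω`. -/
noncomputable def iterAvg (P : Z → ℝ) : ℕ → ℕ → ((ℕ → Z) → ℝ) → (ℕ → Z) → ℝ
  | 0, _, F, ω => F ω
  | n + 1, t, F, ω => ∑ z, P z * iterAvg P n (t + 1) F (Function.update ω t z)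

variable {P : Z → ℝ}

theorem iterAvg_congr (n t : ℕ) {F G : (ℕ → Z) → ℝ} (ω : ℕ → Z)
    (h : ∀ ω', (∀ u < t, ω' u = ω u) → F ω' = G ω') :
    iterAvg P n t F ω = iterAvg P n t G ω := by
  induction n generalizing t ω with
  | zero => exact h ω fun _ _ => rfl
  | succ n ih =>
    refine Finset.sum_congr rfl fun z _ => ?_
    rw [ih (t + 1)]
    intro ω' hω'
    refine h ω' fun u hu => ?_
    rw [hω' u (by omega), Function.update_of_ne (by omega)]

theorem iterAvg_add (n t : ℕ) (F G : (ℕ → Z) → ℝ) (ω : ℕ → Z) :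
    iterAvg P n t (fun ω => F ω + G ω) ω = iterAvg P n t F ω + iterAvg P n t G ω := by
  induction n generalizing t ω with
  | zero => rfl
  | succ n ih => simp only [iterAvg, ih, mul_add, Finset.sum_add_distrib]

theorem iterAvg_const_mul (n t : ℕ) (c : ℝ) (F : (ℕ → Z) → ℝ) (ω : ℕ → Z) :
    iterAvg P n t (fun ω => c * F ω) ω = c * iterAvg P n t F ω := by
  induction n generalizing t ω with
  | zero => rfl
  | succ n ih =>
    simp only [iterAvg, ih, Finset.mul_sum]
    exact Finset.sum_congr rfl fun z _ => by ring

theorem iterAvg_sum {ι : Type*} (I : Finset ι) (n t : ℕ) (F : ι → (ℕ → Z) → ℝ) (ω : ℕ → Z) :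
    iterAvg P n t (fun ω => ∑ i ∈ I, F i ω) ω = ∑ i ∈ I, iterAvg P n t (F i) ω := by
  induction n generalizing t ω with
  | zero => rfl
  | succ n ih =>
    simp only [iterAvg, ih, Finset.mul_sum]
    exact Finset.sum_comm

theorem iterAvg_const (hP : ∑ z, P z = 1) (n t : ℕ) (c : ℝ) (ω : ℕ → Z) :
    iterAvg P n t (fun _ => c) ω = c := by
  induction n generalizing t ω with
  | zero => rfl
  | succ n ih => simp only [iterAvg, ih, ← Finset.sum_mul, hP, one_mul]

theorem iterAvg_mono (hP : ∀ z, 0 ≤ P z) (n t : ℕ) {F G : (ℕ → Z) → ℝ} (h : ∀ ω, F ω ≤ G ω)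
    (ω : ℕ → Z) : iterAvg P n t F ω ≤ iterAvg P n t G ω := by
  induction n generalizing t ω with
  | zero => exact h ω
  | succ n ih => exact Finset.sum_le_sum fun z _ => mul_le_mul_of_nonneg_left (ih _ _) (hP z)

theorem iterAvg_apply (hP : ∑ z, P z = 1) (n t u : ℕ) (h₁ : t ≤ u) (h₂ : u < t + n) (f : Z → ℝ)
    (ω : ℕ → Z) : iterAvg P n t (fun ω => f (ω u)) ω = ∑ z, P z * f z := by
  induction n generalizing t ω with
  | zero => omega
  | succ n ih =>
    rcases h₁.eq_or_lt with rfl | h₁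
    · refine Finset.sum_congr rfl fun z _ => ?_
      rw [iterAvg_congr (G := fun _ => f z), iterAvg_const hP]
      intro ω' hω'
      rw [hω' t (by omega), Function.update_self]
    · simp only [iterAvg, ih (t + 1) h₁ (by omega), ← Finset.sum_mul, hP, one_mul]

theorem exists_weightedSum_le (hP₀ : ∀ z, 0 ≤ P z) (hP : ∑ z, P z = 1) (g : Z → ℝ) :
    ∃ z, ∑ z, P z * g z ≤ g z := by
  by_contra! h
  have h₀ : ∑ z, P z * (∑ z, P z * g z - g z) = 0 := by
    simp only [mul_sub, Finset.sum_sub_distrib, ← Finset.sum_mul, hP, one_mul, sub_self]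
  rw [Finset.sum_eq_zero_iff_of_nonneg
    fun z _ => mul_nonneg (hP₀ z) (sub_pos.2 (h z)).le] at h₀
  have hz : ∀ z, P z = 0 := fun z =>
    (mul_eq_zero.1 (h₀ z (Finset.mem_univ z))).resolve_right (sub_pos.2 (h z)).ne'
  simp [hz] at hP

/-- The probabilistic method, one coordinate at a time. -/
theorem exists_iterAvg_le (hP₀ : ∀ z, 0 ≤ P z) (hP : ∑ z, P z = 1) (n t : ℕ) (F : (ℕ → Z) → ℝ)
    (ω : ℕ → Z) : ∃ ω', iterAvg P n t F ω ≤ F ω' := by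
  induction n generalizing t ω with
  | zero => exact ⟨ω, le_rfl⟩
  | succ n ih =>
    obtain ⟨z, hz⟩ := exists_weightedSum_le hP₀ hP
      fun z => iterAvg P n (t + 1) F (Function.update ω t z)
    obtain ⟨ω', hω'⟩ := ih (t + 1) (Function.update ω t z)
    exact ⟨ω', hz.trans hω'⟩

/-- By `he`, fixing coordinate `t` fixes round `t` and hence the new record, so the average over the
later coordinates passes through the player's own draw. -/
theorem iterAvg_expectedReward_succ (hP : ∑ z, P z = 1) {S X : Type} {M : DdMDP S X} (e : (ℕ → Z) → M.Env)
    (he : ∀ ω ω' t, (∀ u ≤ t, ω u = ω' u) → e ω t = e ω' t) (A : M.Player) (n t : ℕ)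
    (h : List M.Play) (s : S) (ω : ℕ → Z) :
    iterAvg P (n + 1) t (fun ω => M.expectedReward (e ω) A (n + 1) t h s) ω =
      ∑ z, P z * ∑ x : M.Act s, (A h s x).toReal *
        ((e (Function.update ω t z) t).reward s x +
          iterAvg P n (t + 1) (fun ω' => M.expectedReward (e ω') A n (t + 1)
            (⟨s, x, e (Function.update ω t z) t⟩ :: h)
            ((e (Function.update ω t z) t).next s x)) (Function.update ω t z)) := by
  refine Finset.sum_congr rfl fun z _ => ?_
  congr 1
  rw [iterAvg_congr (G := fun ω' => ∑ x : M.Act s, (A h s x).toReal *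
    ((e (Function.update ω t z) t).reward s x + M.expectedReward (e ω') A n (t + 1)
      (⟨s, x, e (Function.update ω t z) t⟩ :: h) ((e (Function.update ω t z) t).next s x)))]
  · rw [iterAvg_sum]
    refine Finset.sum_congr rfl fun x _ => ?_
    rw [iterAvg_const_mul, iterAvg_add, iterAvg_const hP]
  · intro ω' hω'
    rw [expectedReward, he ω' _ t fun u hu => hω' u (Nat.lt_succ_of_le hu)]

end IterAvg

/-! ### Bandits whose arm can be changed only in the rounds divisible by `τ` -/

theorem sum_toReal_pmf {α : Type*} [Fintype α] (p : PMF α) : ∑ x, (p x).toReal = 1 := by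
  rw [← ENNReal.toReal_sum fun x _ => p.apply_ne_top x, ← tsum_fintype (L := .unconditional α),
    p.tsum_coe, ENNReal.toReal_one]

/-- The arm that is used in round `t` if the current state is `s` and the action is `x`. -/
def lockedArm {K : ℕ} (τ t : ℕ) (s x : Fin K) : Fin K := if τ ∣ t then x else s

section Locked

variable (K : ℕ) [NeZero K]

/-- States and actions are the `K` arms, and all actions are feasible. -/
abbrev lockedMDP : DdMDP (Fin K) (Fin K) := ⟨fun _ => Finset.univ, 0⟩

/-- The policy that always plays the action `i`. -/
def constPolicy (i : Fin K) : (lockedMDP K).Policy := fun _ => ⟨i, Finset.mem_univ i⟩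

/-- The policies that always play the same action. -/
def constPolicies : Finset (lockedMDP K).Policy :=
  Finset.univ.map ⟨constPolicy K, fun _ _ h => congrArg Subtype.val (congrFun h 0)⟩

variable {K}

/-- The round `t` in which the arm `a` has reward `v a`. -/
def lockedRound (τ t : ℕ) (v : Fin K → Set.Icc (0 : ℝ) 1) : (lockedMDP K).Round where
  next s x := lockedArm τ t s x.1
  reward s x := v (lockedArm τ t s x.1)
  reward_mem s x := (v (lockedArm τ t s x.1)).2

/-- The sequences in which the rewards of two arms differ by at most `1 / τ` in each round. -/
def lockedFamily (K : ℕ) [NeZero K] (τ : ℕ) : Set (lockedMDP K).Env :=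
  {e | ∃ v : ℕ → Fin K → Set.Icc (0 : ℝ) 1,
    (∀ t a b, (v t a : ℝ) - v t b ≤ 1 / τ) ∧ e = fun t => lockedRound τ t (v t)}

/-- The number of rounds among `t, …, t + n - 1` that precede the next multiple of `τ`. -/
def lockedRounds (τ : ℕ) : ℕ → ℕ → ℕ
  | 0, _ => 0
  | n + 1, t => if τ ∣ t then 0 else lockedRounds τ n (t + 1) + 1

theorem lockedRounds_of_dvd {τ t : ℕ} (n : ℕ) (h : τ ∣ t) : lockedRounds τ n t = 0 := by
  cases n <;> simp [lockedRounds, h]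

theorem lockedRounds_le (τ n t : ℕ) : lockedRounds τ n t ≤ n := by
  induction n generalizing t with
  | zero => rfl
  | succ n ih =>
    rw [lockedRounds]
    split_ifs
    · omega
    · exact Nat.succ_le_succ (ih _)

/-- Within a block, each step raises the residue of `t` by one and uses up one locked round. -/
theorem lockedRounds_add_mod_le {τ : ℕ} (hτ : 0 < τ) (n t : ℕ) (ht : ¬ τ ∣ t) :
    lockedRounds τ n t + t % τ ≤ τ := by
  induction n generalizing t with
  | zero => simpa [lockedRounds] using (Nat.mod_lt t hτ).le
  | succ n ih =>
    rw [lockedRounds, if_neg ht]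
    by_cases h : τ ∣ t + 1
    · rw [lockedRounds_of_dvd n h]
      have := Nat.mod_lt t hτ
      omega
    · have := ih (t + 1) h
      have h₁ : (t + 1) % τ = t % τ + 1 := by
        rw [Nat.dvd_iff_mod_eq_zero] at h
        rw [Nat.add_mod_eq_ite] at h ⊢
        rcases (Nat.succ_le_of_lt hτ).eq_or_lt with h₂ | h₂
        · simp [← h₂] at ht
        · have h₃ := Nat.mod_lt t hτ
          rw [Nat.mod_eq_of_lt h₂] at h ⊢
          split_ifs at h ⊢ <;> omega
      omega

theorem lockedRounds_le_period {τ : ℕ} (hτ : 0 < τ) (n t : ℕ) : lockedRounds τ n t ≤ τ := by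
  by_cases h : τ ∣ t
  · simp [lockedRounds_of_dvd n h]
  · have := lockedRounds_add_mod_le hτ n t h
    omega

/-- Round `0` is divisible by `τ`, so the initial arm is abandoned at once. -/
theorem policyState_const (τ : ℕ) (v : ℕ → Fin K → Set.Icc (0 : ℝ) 1) (i : Fin K) (t : ℕ) :
    (lockedMDP K).policyState (fun t => lockedRound τ t (v t)) (constPolicy K i) (t + 1) = i := by
  induction t with
  | zero => simp [policyState, lockedRound, lockedArm, constPolicy]
  | succ t ih =>
    rw [policyState, ih]
    simp [lockedRound, lockedArm, constPolicy]

theorem policyReward_const (τ : ℕ) (v : ℕ → Fin K → Set.Icc (0 : ℝ) 1) (i : Fin K) (t : ℕ) :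
    (lockedMDP K).policyReward (fun t => lockedRound τ t (v t)) (constPolicy K i) t = v t i := by
  cases t with
  | zero => simp [policyReward, lockedRound, lockedArm, constPolicy]
  | succ t =>
    rw [policyReward, policyState_const]
    simp [lockedRound, lockedArm, constPolicy]

/-- The player that plays the policy `γ`. -/
noncomputable def purePlayer {S X : Type} {M : DdMDP S X} (γ : M.Policy) : M.Player :=
  fun _ s => PMF.pure (γ s)

theorem expectedReward_purePlayer_succ {S X : Type} {M : DdMDP S X} (e : M.Env) (γ : M.Policy)
    (n t : ℕ) (h : List M.Play) (s : S) :
    M.expectedReward e (purePlayer γ) (n + 1) t h s = (e t).reward s (γ s) +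
      M.expectedReward e (purePlayer γ) n (t + 1) (⟨s, γ s, e t⟩ :: h) ((e t).next s (γ s)) := by
  rw [expectedReward, Finset.sum_eq_single (γ s)]
  · simp [purePlayer]
  · intro x _ hx
    simp [purePlayer, PMF.pure_apply_of_ne _ _ hx]
  · simp

/-- Only locked rounds on a wrong arm cost anything, at most `1 / τ` each. In a round divisible by
`τ` the action takes effect in the same round, so nothing is lost from there on. -/
theorem le_expectedReward_constPolicy {τ : ℕ} {v : ℕ → Fin K → Set.Icc (0 : ℝ) 1}
    (hv : ∀ t a b, (v t a : ℝ) - v t b ≤ 1 / τ) (i : Fin K) (n t : ℕ)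
    (h : List (lockedMDP K).Play) (s : Fin K) :
    ∑ u ∈ Finset.Ico t (t + n), (v u i : ℝ) - (if s = i then (0 : ℝ) else (lockedRounds τ n t : ℝ) / τ) ≤
      (lockedMDP K).expectedReward (fun t => lockedRound τ t (v t))
        (purePlayer (constPolicy K i)) n t h s := by
  induction n generalizing t h s with
  | zero => simp [lockedRounds, expectedReward]
  | succ n ih =>
    rw [expectedReward_purePlayer_succ, Finset.sum_eq_sum_Ico_succ_bot (by omega)]
    have := ih (t + 1) (⟨s, constPolicy K i s, lockedRound τ t (v t)⟩ :: h) (lockedArm τ t s i)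
    rw [show t + 1 + n = t + (n + 1) by ring] at this
    refine le_trans ?_ (add_le_add (le_refl (v t (lockedArm τ t s i) : ℝ)) this)
    have h₁ := hv t i s
    by_cases hd : τ ∣ t
    · simp only [lockedArm, hd, lockedRounds, if_true]
      simp
    · simp only [lockedArm, hd, lockedRounds, if_false]
      split_ifs with hsi
      · subst hsi
        linarith
      · push_cast
        rw [add_div]
        linarith

theorem locked_chasesWithin {τ T : ℕ} (hτ : 0 < τ) :
    (lockedMDP K).ChasesWithin (constPolicies K) T (lockedFamily K τ)
      (fun γ _ => purePlayer γ) 1 := by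
  rintro e ⟨v, hv, rfl⟩ γ hγ t n - s
  obtain ⟨i, -, rfl⟩ := Finset.mem_map.1 hγ
  have h₁ := le_expectedReward_constPolicy hv i n t [] s
  have h₂ : (lockedRounds τ n t : ℝ) / τ ≤ 1 :=
    div_le_one_of_le₀ (by exact_mod_cast lockedRounds_le_period hτ n t) (by positivity)
  change ∑ u ∈ Finset.Ico t (t + n), (lockedMDP K).policyReward _ (constPolicy K i) u -
    (lockedMDP K).expectedReward _ (purePlayer (constPolicy K i)) n t [] s ≤ 1
  simp only [policyReward_const]
  split_ifs at h₁ <;> linarith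

theorem locked_isBanditChasable {τ T : ℕ} (hτ : 0 < τ) :
    (lockedMDP K).IsBanditChasable (constPolicies K) T (lockedFamily K τ) 1 :=
  ⟨fun γ _ => purePlayer γ, fun _ _ _ _ _ => rfl, locked_chasesWithin hτ⟩

theorem constPolicies_nonempty : (constPolicies K).Nonempty := by
  simp [constPolicies]

theorem card_constPolicies : (constPolicies K).card = K := by simp [constPolicies]

theorem le_regret (τ T : ℕ) (v : ℕ → Fin K → Set.Icc (0 : ℝ) 1) (A : (lockedMDP K).Player)
    (i : Fin K) :
    ∑ t ∈ Finset.range T, (v t i : ℝ) - (lockedMDP K).expectedReward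
        (fun t => lockedRound τ t (v t)) A T 0 [] 0 ≤
      (lockedMDP K).regret (constPolicies K) constPolicies_nonempty T
        (fun t => lockedRound τ t (v t)) A := by
  refine sub_le_sub_right ?_ _
  have hi : constPolicy K i ∈ constPolicies K := Finset.mem_map_of_mem _ (Finset.mem_univ i)
  refine le_trans (le_of_eq ?_) (Finset.le_sup' _ hi)
  simp only [policyReward_const]

end Locked

/-! ### Values of a bandit player and change of measure -/

section LockedBandit

variable {K : ℕ} [NeZero K] {τ : ℕ}

/-- The reward `k / τ`. -/
noncomputable def level {τ : ℕ} (k : Fin (τ + 1)) : Set.Icc (0 : ℝ) 1 :=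
  ⟨(k : ℕ) / (τ : ℝ), by positivity,
    div_le_one_of_le₀ (by exact_mod_cast Nat.le_of_lt_succ k.2) (by positivity)⟩

/-- The expected total pay of the player `A` in the rounds `t, …, t + n - 1` if in each round
divisible by `τ` a new level is drawn with weights `q a`, where `a` is the arm chosen in this round,
and in each round all arms have the reward of the present level. -/
noncomputable def levelValue (A : (lockedMDP K).Player) (q : Fin K → Fin (τ + 1) → ℝ)
    (pay : ℕ → ℕ → Fin K → Fin (τ + 1) → ℝ) :
    ℕ → ℕ → List (lockedMDP K).Play → Fin K → Fin (τ + 1) → ℝ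
  | 0, _, _, _, _ => 0
  | n + 1, t, h, s, k => ∑ x : (lockedMDP K).Act s, (A h s x).toReal *
      if τ ∣ t then
        ∑ k', q x.1 k' * (pay n t x.1 k' +
          levelValue A q pay n (t + 1) (⟨s, x, lockedRound τ t fun _ => level k'⟩ :: h) x.1 k')
      else pay n t s k +
        levelValue A q pay n (t + 1) (⟨s, x, lockedRound τ t fun _ => level k⟩ :: h) s k

variable {A : (lockedMDP K).Player} {q : Fin K → Fin (τ + 1) → ℝ}
  {pay : ℕ → ℕ → Fin K → Fin (τ + 1) → ℝ} {n t : ℕ} {h : List (lockedMDP K).Play} {s i : Fin K}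
  {k : Fin (τ + 1)}

theorem levelValue_succ_of_dvd (ht : τ ∣ t) :
    levelValue A q pay (n + 1) t h s k = ∑ x : (lockedMDP K).Act s, (A h s x).toReal *
      ∑ k', q x.1 k' * (pay n t x.1 k' +
        levelValue A q pay n (t + 1) (⟨s, x, lockedRound τ t fun _ => level k'⟩ :: h) x.1 k') := by
  simp only [levelValue, if_pos ht]

theorem levelValue_succ_of_not_dvd (ht : ¬ τ ∣ t) :
    levelValue A q pay (n + 1) t h s k = ∑ x : (lockedMDP K).Act s, (A h s x).toReal *
      (pay n t s k +
        levelValue A q pay n (t + 1) (⟨s, x, lockedRound τ t fun _ => level k⟩ :: h) s k) := by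
  simp only [levelValue, if_neg ht]

theorem sum_act_const (A : (lockedMDP K).Player) (h : List (lockedMDP K).Play) (s : Fin K)
    (c : ℝ) : ∑ x : (lockedMDP K).Act s, (A h s x).toReal * c = c := by
  rw [← Finset.sum_mul, sum_toReal_pmf, one_mul]

/-- The pay `w` for each choice of the arm `i` in the rounds divisible by `τ`. -/
noncomputable def armPay (τ : ℕ) (i : Fin K) (w : ℕ → ℕ → ℝ) :
    ℕ → ℕ → Fin K → Fin (τ + 1) → ℝ :=
  fun n t a _ => if τ ∣ t ∧ a = i then w n t else 0

/-- The number of rounds in which the arm chosen in round `t` is used, if `n` rounds follow. -/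
noncomputable def armRounds (τ n t : ℕ) : ℝ := lockedRounds τ n (t + 1) + 1

theorem levelValue_nonneg (hq : ∀ a k, 0 ≤ q a k) (hpay : ∀ n t a k, 0 ≤ pay n t a k) :
    0 ≤ levelValue A q pay n t h s k := by
  induction n generalizing t h s k with
  | zero => exact le_rfl
  | succ n ih =>
    rw [levelValue]
    refine Finset.sum_nonneg fun x _ => mul_nonneg ENNReal.toReal_nonneg ?_
    split_ifs
    · exact Finset.sum_nonneg fun k' _ => mul_nonneg (hq _ _) (add_nonneg (hpay _ _ _ _) ih)
    · exact add_nonneg (hpay _ _ _ _) ih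

/-- A drawn level is paid throughout its block, so each round of a new block is worth `μ`, plus `g`
if its arm is `i`; `armRounds` credits all these rounds at the moment of the choice. The first term
is the rest of the running block, whose level is already known. -/
theorem levelValue_reward {μ g : ℝ} (hq₁ : ∀ a, ∑ k, q a k = 1)
    (hq₂ : ∀ a, ∑ k, q a k * (level k : ℝ) = μ + g * if a = i then 1 else 0) :
    levelValue A q (fun _ _ _ k => level k) n t h s k = lockedRounds τ n t * level k +
      (n - lockedRounds τ n t) * μ + g * levelValue A q (armPay τ i (armRounds τ)) n t h s k := by
  induction n generalizing t h s k with
  | zero => simp [levelValue, lockedRounds]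
  | succ n ih =>
    by_cases ht : τ ∣ t
    · rw [levelValue_succ_of_dvd ht, levelValue_succ_of_dvd ht, lockedRounds_of_dvd _ ht,
        ← sum_act_const A h s (((0 : ℕ) : ℝ) * level k + ((n + 1 : ℕ) - ((0 : ℕ) : ℝ)) * μ),
        Finset.mul_sum, ← Finset.sum_add_distrib]
      refine Finset.sum_congr rfl fun x _ => ?_
      simp only [ih, armPay, ht, true_and]
      set m : ℝ := ((lockedRounds τ n (t + 1) : ℕ) : ℝ) with hm
      have h₁ : ∀ k' : Fin (τ + 1), q x.1 k' * ((level k' : ℝ) + (m * level k' + (n - m) * μ +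
          g * levelValue A q (armPay τ i (armRounds τ)) n (t + 1)
            (⟨s, x, lockedRound τ t fun _ => level k'⟩ :: h) x.1 k')) =
          (m + 1) * (q x.1 k' * level k') + ((n - m) * μ) * q x.1 k' +
          g * (q x.1 k' * levelValue A q (armPay τ i (armRounds τ)) n (t + 1)
            (⟨s, x, lockedRound τ t fun _ => level k'⟩ :: h) x.1 k') := fun k' => by ring
      simp only [h₁, Finset.sum_add_distrib, ← Finset.mul_sum, hq₁, hq₂, mul_add, armRounds]
      simp only [← Finset.sum_mul, hq₁, ← hm]
      push_cast
      split_ifs <;> ring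
    · rw [levelValue_succ_of_not_dvd ht, levelValue_succ_of_not_dvd ht, lockedRounds, if_neg ht,
        ← sum_act_const A h s (((lockedRounds τ n (t + 1) + 1 : ℕ) : ℝ) * level k +
          ((n + 1 : ℕ) - ((lockedRounds τ n (t + 1) + 1 : ℕ) : ℝ)) * μ),
        Finset.mul_sum, ← Finset.sum_add_distrib]
      refine Finset.sum_congr rfl fun x _ => ?_
      simp only [ih, armPay, ht, false_and, if_false]
      push_cast
      ring

/-- Each round divisible by `τ` selects exactly one arm, so the total over `i` does not depend on
the player. -/
theorem sum_levelValue_armPay {w W : ℕ → ℕ → ℝ} (hq₁ : ∀ a, ∑ k, q a k = 1)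
    (hW₀ : ∀ t, W 0 t = 0)
    (hW : ∀ n t, W (n + 1) t = (if τ ∣ t then w n t else 0) + W n (t + 1)) :
    ∑ i, levelValue A q (armPay τ i w) n t h s k = W n t := by
  induction n generalizing t h s k with
  | zero => simp [levelValue, hW₀]
  | succ n ih =>
    by_cases ht : τ ∣ t
    · simp only [levelValue_succ_of_dvd ht]
      rw [Finset.sum_comm, ← sum_act_const A h s (W (n + 1) t)]
      refine Finset.sum_congr rfl fun x _ => ?_
      rw [← Finset.mul_sum, Finset.sum_comm]
      have h₁ : ∀ k', ∑ i, armPay τ i w n t x.1 k' = w n t := fun k' => by simp [armPay, ht]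
      simp only [← Finset.mul_sum, Finset.sum_add_distrib, ih, h₁]
      rw [← Finset.sum_mul, hq₁, hW, if_pos ht, one_mul]
    · simp only [levelValue_succ_of_not_dvd ht]
      rw [Finset.sum_comm, ← sum_act_const A h s (W (n + 1) t)]
      refine Finset.sum_congr rfl fun x _ => ?_
      simp only [← Finset.mul_sum, Finset.sum_add_distrib, ih]
      simp [armPay, ht, hW]

theorem sum_levelValue_armRounds (hq₁ : ∀ a, ∑ k, q a k = 1) :
    ∑ i, levelValue A q (armPay τ i (armRounds τ)) n t h s k = n - lockedRounds τ n t := by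
  refine sum_levelValue_armPay (W := fun n t => n - lockedRounds τ n t) hq₁
    (fun t => by simp [lockedRounds]) fun n t => ?_
  by_cases ht : τ ∣ t
  · simp only [lockedRounds_of_dvd _ ht, armRounds, if_pos ht]
    push_cast
    ring
  · simp only [lockedRounds, if_neg ht]
    push_cast
    ring

theorem sum_levelValue_one (hq₁ : ∀ a, ∑ k, q a k = 1) :
    ∑ i, levelValue A q (armPay τ i fun _ _ => 1) n 0 h s k ≤ n / τ + 1 := by
  rw [sum_levelValue_armPay (W := fun n t => ∑ u ∈ Finset.range n, if τ ∣ t + u then (1 : ℝ) else 0)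
    hq₁ (fun t => by simp) fun n t => ?_]
  -- With the term `n` added, the sum counts round `0` and the multiples of `τ` in `1, …, n`.
  · refine le_trans (Finset.sum_le_sum_of_subset_of_nonneg
      (Finset.range_mono (Nat.le_succ n)) fun _ _ _ => by split_ifs <;> norm_num) ?_
    rw [Finset.sum_range_succ']
    have h₁ := Nat.card_multiples n τ
    simp only [zero_add, dvd_zero, if_true, Finset.sum_boole, h₁]
    exact add_le_add_left Nat.cast_div_le 1
  · simp only [Finset.sum_range_succ', add_zero]
    rw [add_comm]
    congr 1
    exact Finset.sum_congr rfl fun u _ => by rw [add_assoc, add_comm u 1]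

/-- A bound for the change of expectations of variables with values in `[0, 1]` under a change of
measure with density `ℓ`. -/
noncomputable def densityBound (μ ℓ : ℝ) : ℝ := (ℓ - 1) + (ℓ - 1 - Real.log ℓ) / μ + μ

/-- Applying `log r ≤ r - 1` to `r = √ℓ` gives the lower bound `(1 - r)²`, and `(1 - r²)² ≤ 4 (1 -
r)²`. -/
theorem sub_one_sub_log_ge {ℓ : ℝ} (hℓ : 0 < ℓ) (hℓ₁ : ℓ ≤ 1) :
    (1 - ℓ) ^ 2 / 4 ≤ ℓ - 1 - Real.log ℓ := by
  have h₀ := Real.sqrt_pos.2 hℓ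
  have h₁ := Real.log_le_sub_one_of_pos h₀
  rw [Real.log_sqrt hℓ.le] at h₁
  have h₂ := Real.sq_sqrt hℓ.le
  have h₃ : Real.sqrt ℓ ≤ 1 := Real.sqrt_le_one.2 hℓ₁
  set r := Real.sqrt ℓ
  rw [← h₂] at h₁ ⊢
  have h₄ : (1 - r ^ 2) ^ 2 / 4 ≤ (1 - r) ^ 2 := by
    have : (1 - r ^ 2) ^ 2 = (1 - r) ^ 2 * (1 + r) ^ 2 := by ring
    nlinarith [mul_le_mul_of_nonneg_left (show (1 + r) ^ 2 ≤ 4 by nlinarith) (sq_nonneg (1 - r))]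
  nlinarith

/-- For `ℓ ≤ 1` this is the inequality of means, `(1 - ℓ)² / (4 μ) + μ ≥ 1 - ℓ`. Together with the
next lemma, `densityBound μ` majorizes the positive part of `ℓ - 1`. -/
theorem densityBound_nonneg {μ ℓ : ℝ} (hμ : 0 < μ) (hℓ : 0 < ℓ) : 0 ≤ densityBound μ ℓ := by
  have h₀ := Real.log_le_sub_one_of_pos hℓ
  rw [densityBound]
  rcases le_total 1 ℓ with h₁ | h₁
  · have := div_nonneg (sub_nonneg.2 h₀) hμ.le
    linarith
  · have h₂ := div_le_div_of_nonneg_right (sub_one_sub_log_ge hℓ h₁) hμ.le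
    have h₃ : (1 - ℓ) ^ 2 / 4 / μ + μ - (1 - ℓ) = ((1 - ℓ) / 2 - μ) ^ 2 / μ := by
      field_simp
      ring
    have h₄ : 0 ≤ ((1 - ℓ) / 2 - μ) ^ 2 / μ := by positivity
    linarith

theorem sub_one_le_densityBound {μ ℓ : ℝ} (hμ : 0 < μ) (hℓ : 0 < ℓ) :
    ℓ - 1 ≤ densityBound μ ℓ := by
  have h₀ := Real.log_le_sub_one_of_pos hℓ
  have := div_nonneg (sub_nonneg.2 h₀) hμ.le
  rw [densityBound]
  linarith

/-- The density is a martingale under `p`, so only the logarithm drifts, by the relative entropy. -/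
theorem sum_densityBound {ι : Type*} [Fintype ι] {p r : ι → ℝ} {κ μ ℓ : ℝ} (hμ : 0 < μ)
    (hp₁ : ∑ k, p k = 1) (hr : ∀ k, 0 < r k) (hpr : ∑ k, p k * r k = 1)
    (hκ : -∑ k, p k * Real.log (r k) ≤ κ) (hℓ : 0 < ℓ) :
    ∑ k, p k * densityBound μ (ℓ * r k) ≤ densityBound μ ℓ + κ / μ := by
  have h₁ : ∀ k, p k * densityBound μ (ℓ * r k) = (ℓ + ℓ / μ) * (p k * r k) -
      p k * (1 + (1 + Real.log ℓ) / μ - μ) - p k * Real.log (r k) * (1 / μ) := by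
    intro k
    rw [densityBound, Real.log_mul hℓ.ne' (hr k).ne']
    ring
  simp only [h₁, Finset.sum_sub_distrib, ← Finset.mul_sum, ← Finset.sum_mul, hp₁, hpr]
  have h₂ := div_le_div_of_nonneg_right hκ hμ.le
  rw [densityBound]
  have h₃ : -(∑ k, p k * Real.log (r k)) / μ = -((∑ k, p k * Real.log (r k)) * (1 / μ)) := by ring
  rw [h₃] at h₂
  have h₄ : (ℓ + ℓ / μ) * 1 - 1 * (1 + (1 + Real.log ℓ) / μ - μ) =
    (ℓ - 1) + (ℓ - 1 - Real.log ℓ) / μ + μ := by ring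
  rw [h₄]
  linarith

/-- Change of measure: `p` is the law of the levels of all arms, and the law of the levels of the
arm `i` is changed to `p * r`. -/
theorem levelValue_change_of_measure {p r : Fin (τ + 1) → ℝ} {κ μ ℓ : ℝ} (hμ : 0 < μ)
    (hp : ∀ k, 0 ≤ p k) (hp₁ : ∑ k, p k = 1) (hr : ∀ k, 0 < r k) (hpr : ∑ k, p k * r k = 1)
    (hκ : -∑ k, p k * Real.log (r k) ≤ κ) (hκ₀ : 0 ≤ κ) (hℓ : 0 < ℓ) :
    ℓ * levelValue A (fun a k => p k * if a = i then r k else 1) (armPay τ i (armRounds τ)) n t h s k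
        - levelValue A (fun _ k => p k) (armPay τ i (armRounds τ)) n t h s k ≤
      (n - lockedRounds τ n t) * (densityBound μ ℓ +
        κ / μ * levelValue A (fun _ k => p k) (armPay τ i fun _ _ => 1) n t h s k) := by
  -- Here `ℓ` is the likelihood ratio of the past. The potential `densityBound μ ℓ` pays for the
  -- advantage in the current block, and its mean grows by at most `κ / μ` per choice of `i`, which
  -- the second term counts.
  induction n generalizing t h s k ℓ with
  | zero => simp [levelValue, lockedRounds]
  | succ n ih =>
    by_cases ht : τ ∣ t
    · simp only [levelValue_succ_of_dvd ht, lockedRounds_of_dvd _ ht]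
      rw [← sum_act_const A h s (densityBound μ ℓ), Finset.mul_sum, Finset.mul_sum,
        ← Finset.sum_sub_distrib, ← Finset.sum_add_distrib, Finset.mul_sum]
      refine Finset.sum_le_sum fun x _ => ?_
      have hA : 0 ≤ (A h s x).toReal := ENNReal.toReal_nonneg
      set N₁ := fun k' => levelValue A (fun a k => p k * if a = i then r k else 1)
        (armPay τ i (armRounds τ)) n (t + 1)
        (⟨s, x, lockedRound τ t fun _ => level k'⟩ :: h) x.1 k'
      set N₀ := fun k' => levelValue A (fun _ k => p k) (armPay τ i (armRounds τ)) n (t + 1)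
        (⟨s, x, lockedRound τ t fun _ => level k'⟩ :: h) x.1 k'
      set M := fun k' => levelValue A (fun _ k => p k) (armPay τ i fun _ _ => 1) n (t + 1)
        (⟨s, x, lockedRound τ t fun _ => level k'⟩ :: h) x.1 k' with hM
      have hM₀ : ∀ k', 0 ≤ M k' := fun k' => levelValue_nonneg (fun _ => hp)
        fun _ _ _ _ => by rw [armPay]; split_ifs <;> norm_num
      set ρ : Fin (τ + 1) → ℝ := fun k' => if x.1 = i then r k' else 1 with hρ
      have hρ₀ : ∀ k', 0 < ρ k' := fun k' => by
        simp only [hρ]; split_ifs; exacts [hr k', one_pos]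
      set δ : ℝ := if x.1 = i then 1 else 0 with hδ
      have hδ₀ : 0 ≤ δ ∧ δ ≤ 1 := by rw [hδ]; split_ifs <;> norm_num
      have hsum : ∑ k', p k' * densityBound μ (ℓ * ρ k') ≤ densityBound μ ℓ + κ / μ * δ := by
        by_cases hx : x.1 = i
        · simpa [hρ, hδ, hx] using sum_densityBound hμ hp₁ hr hpr hκ hℓ
        · simp [hρ, hδ, hx, ← Finset.sum_mul, hp₁]
      have hpay : ∀ w : ℕ → ℕ → ℝ, ∀ k', armPay τ i w n t x.1 k' = δ * w n t := by
        intro w k'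
        simp [armPay, ht, hδ]
      set m : ℝ := ((lockedRounds τ n (t + 1) : ℕ) : ℝ)
      have hm : m ≤ n := Nat.cast_le.2 (lockedRounds_le τ n (t + 1))
      have hm₀ : 0 ≤ m := Nat.cast_nonneg _
      have key : ∀ k', ℓ * (p k' * ρ k' * (δ * (m + 1) + N₁ k')) - p k' * (δ * (m + 1) + N₀ k') ≤
          (n + 1) * (p k' * densityBound μ (ℓ * ρ k') + κ / μ * (p k' * M k')) := by
        intro k'
        have hℓ' : 0 < ℓ * ρ k' := mul_pos hℓ (hρ₀ k')
        have h₁ : ℓ * ρ k' * N₁ k' - N₀ k' ≤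
          (n - m) * (densityBound μ (ℓ * ρ k') + κ / μ * M k') := ih hℓ'
        have h₂ : δ * (ℓ * ρ k' - 1) ≤ densityBound μ (ℓ * ρ k') := by
          have h₃ := sub_one_le_densityBound hμ hℓ'
          have h₄ := densityBound_nonneg hμ hℓ'
          rw [hδ]
          split_ifs <;> linarith
        have h₃ : 0 ≤ κ / μ * M k' := mul_nonneg (div_nonneg hκ₀ hμ.le) (hM₀ k')
        -- The `m + 1` rounds of the new block are charged to `h₂`, the `n - m` later ones to `h₁`.
        have h₄ : ℓ * ρ k' * (δ * (m + 1) + N₁ k') - (δ * (m + 1) + N₀ k') ≤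
            (n + 1) * (densityBound μ (ℓ * ρ k') + κ / μ * M k') := by
          nlinarith [mul_le_mul_of_nonneg_right h₂ (show 0 ≤ m + 1 by linarith),
            mul_nonneg (show 0 ≤ m + 1 by linarith) h₃]
        nlinarith [mul_le_mul_of_nonneg_left h₄ (hp k')]
      simp only [hpay, armRounds, mul_one]
      have hfin : ℓ * ∑ k', p k' * ρ k' * (δ * (m + 1) + N₁ k') -
          ∑ k', p k' * (δ * (m + 1) + N₀ k') ≤ (n + 1) * (densityBound μ ℓ +
            κ / μ * ∑ k', p k' * (δ + M k')) := by
        rw [Finset.mul_sum, ← Finset.sum_sub_distrib]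
        refine (Finset.sum_le_sum fun k' _ => key k').trans ?_
        rw [← Finset.mul_sum, Finset.sum_add_distrib, ← Finset.mul_sum]
        refine mul_le_mul_of_nonneg_left ?_ (by positivity)
        simp only [mul_add, Finset.sum_add_distrib, ← Finset.sum_mul, hp₁, one_mul]
        linarith
      have := mul_le_mul_of_nonneg_left hfin hA
      push_cast
      calc _ = (A h s x).toReal * (ℓ * ∑ k', p k' * ρ k' * (δ * (m + 1) + N₁ k') -
          ∑ k', p k' * (δ * (m + 1) + N₀ k')) := by ring
        _ ≤ _ := this
        _ = _ := by ring
    · simp only [levelValue_succ_of_not_dvd ht, lockedRounds, if_neg ht]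
      rw [← sum_act_const A h s (densityBound μ ℓ), Finset.mul_sum, Finset.mul_sum,
        ← Finset.sum_sub_distrib, ← Finset.sum_add_distrib, Finset.mul_sum]
      refine Finset.sum_le_sum fun x _ => ?_
      have := mul_le_mul_of_nonneg_left
        (ih (t := t + 1) (h := ⟨s, x, lockedRound τ t fun _ => level k⟩ :: h) (s := s) (k := k) hℓ)
        (ENNReal.toReal_nonneg : 0 ≤ (A h s x).toReal)
      simp only [armPay, ht, false_and, if_false, zero_add] at this ⊢
      push_cast
      refine le_trans (le_of_eq ?_) (this.trans (le_of_eq ?_)) <;> ring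

end LockedBandit

/-! ### The noisy adversary and the bandit lower bound -/

section NoisyArms

/-- The probability that the level `k` of the good arm is raised. -/
noncomputable def shiftProb (τ : ℕ) (k : ℝ) : ℝ := (τ - k) * (k + 1) / (16 * τ ^ 2)

/-- The density of the levels of the good arm with respect to the uniform distribution. -/
noncomputable def levelRatio (τ : ℕ) (k : ℝ) : ℝ := 1 - (τ - 2 * k) / (16 * τ ^ 2)

/-- The law of the common level and of the indicator that the level of the good arm is raised. -/
noncomputable def noiseWeight (τ : ℕ) (z : Fin (τ + 1) × Bool) : ℝ :=
  1 / (τ + 1) * if z.2 then shiftProb τ (z.1 : ℕ) else 1 - shiftProb τ (z.1 : ℕ)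

/-- The weights of the levels of the arm `a` if `i` is the good arm. -/
noncomputable def levelWeight {K : ℕ} (τ : ℕ) (i a : Fin K) (k : Fin (τ + 1)) : ℝ :=
  1 / (τ + 1) * if a = i then levelRatio τ (k : ℕ) else 1

/-- The next level, if there is one. -/
def raise {τ : ℕ} (k : Fin (τ + 1)) : Fin (τ + 1) := ⟨min τ (k + 1), by omega⟩

/-- The level of the arm `a` if `i` is the good arm. -/
def armLevel {K τ : ℕ} (i a : Fin K) (z : Fin (τ + 1) × Bool) : Fin (τ + 1) :=
  if a = i ∧ z.2 = true then raise z.1 else z.1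

theorem sum_noiseWeight_mul {τ : ℕ} (f : Fin (τ + 1) → Bool → ℝ) :
    ∑ z, noiseWeight τ z * f z.1 z.2 = ∑ k : Fin (τ + 1), 1 / ((τ : ℝ) + 1) *
      (shiftProb τ (k : ℕ) * f k true + (1 - shiftProb τ (k : ℕ)) * f k false) := by
  rw [Fintype.sum_prod_type]
  refine Finset.sum_congr rfl fun k _ => ?_
  simp only [Fintype.sum_bool, noiseWeight, if_true, Bool.false_eq_true, if_false]
  ring

theorem sum_uniform (τ : ℕ) : ∑ _k : Fin (τ + 1), 1 / ((τ : ℝ) + 1) = 1 := by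
  rw [Finset.sum_const, Finset.card_univ, Fintype.card_fin, nsmul_eq_mul]
  push_cast
  field_simp

theorem sum_noiseWeight (τ : ℕ) : ∑ z, noiseWeight τ z = 1 := by
  have h := sum_noiseWeight_mul (τ := τ) fun _ _ => 1
  simp only [mul_one, add_sub_cancel] at h
  rw [h, sum_uniform]

theorem shiftProb_mem {τ : ℕ} (hτ : 0 < τ) (k : Fin (τ + 1)) :
    0 ≤ shiftProb τ (k : ℕ) ∧ shiftProb τ (k : ℕ) ≤ 1 := by
  have h₁ : ((k : ℕ) : ℝ) ≤ τ := by exact_mod_cast Nat.le_of_lt_succ k.2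
  have h₂ : (1 : ℝ) ≤ τ := by exact_mod_cast hτ
  have h₃ : (0 : ℝ) ≤ (k : ℕ) := Nat.cast_nonneg _
  refine ⟨div_nonneg (mul_nonneg (by linarith) (by linarith)) (by positivity),
    div_le_one_of_le₀ ?_ (by positivity)⟩
  nlinarith

theorem noiseWeight_nonneg {τ : ℕ} (hτ : 0 < τ) (z : Fin (τ + 1) × Bool) :
    0 ≤ noiseWeight τ z := by
  have := shiftProb_mem hτ z.1
  refine mul_nonneg (by positivity) ?_
  split_ifs <;> linarith

theorem abs_one_sub_levelRatio_le {τ : ℕ} (hτ : 0 < τ) {k : ℝ} (hk₀ : 0 ≤ k) (hk : k ≤ τ) :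
    |(τ - 2 * k) / (16 * (τ : ℝ) ^ 2)| ≤ 1 / (16 * (τ : ℝ)) := by
  have h₂ : (0 : ℝ) < τ := by exact_mod_cast hτ
  rw [abs_div, abs_of_pos (by positivity : 0 < 16 * (τ : ℝ) ^ 2)]
  have h₁ : |(τ : ℝ) - 2 * k| ≤ τ := abs_le.2 ⟨by linarith, by linarith⟩
  calc _ ≤ (τ : ℝ) / (16 * τ ^ 2) := by gcongr
    _ = _ := by field_simp

/-- Mass balance: level `k` of the good arm loses the fraction `shiftProb τ k` and receives
`shiftProb τ (k - 1)`. The quadratic form of `shiftProb` makes the resulting density linear in `k`,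
within `O(1 / τ)` of `1`. -/
theorem sum_noiseWeight_armLevel {K τ : ℕ} (hτ : 0 < τ) (i a : Fin K) (G : Fin (τ + 1) → ℝ) :
    ∑ z, noiseWeight τ z * G (armLevel i a z) = ∑ k, levelWeight τ i a k * G k := by
  have h := sum_noiseWeight_mul fun k b => G (armLevel i a (k, b))
  simp only [Prod.mk.eta] at h
  rw [h]
  by_cases ha : a = i
  · have h₀ : (τ : ℝ) ≠ 0 := by exact_mod_cast hτ.ne'
    -- `shiftProb` vanishes at `τ` and at `-1`, so both boundary terms drop and the cap in `raise`
    -- never matters.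
    have h₁ : ∑ k : Fin (τ + 1), shiftProb τ (k : ℕ) * G (raise k) =
        ∑ k : Fin (τ + 1), shiftProb τ ((k : ℕ) - 1 : ℝ) * G k := by
      rw [Fin.sum_univ_castSucc, Fin.sum_univ_succ (fun k : Fin (τ + 1) =>
        shiftProb τ ((k : ℕ) - 1 : ℝ) * G k)]
      have h₂ : ∀ k : Fin τ, raise k.castSucc = k.succ := fun k => by
        ext
        simp only [raise, Fin.val_castSucc, Fin.val_succ]
        omega
      simp [h₂, shiftProb]
    have h₂ : ∀ k : Fin (τ + 1), levelRatio τ (k : ℕ) =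
        1 - shiftProb τ (k : ℕ) + shiftProb τ ((k : ℕ) - 1 : ℝ) := fun k => by
      rw [levelRatio, shiftProb, shiftProb]
      field_simp
      ring
    simp only [armLevel, levelWeight, ha, true_and, if_true, Bool.false_eq_true, if_false, h₂,
      mul_assoc, ← Finset.mul_sum, Finset.sum_add_distrib, add_mul, h₁]
    ring
  · refine Finset.sum_congr rfl fun k _ => ?_
    simp only [armLevel, levelWeight, ha, false_and, if_false]
    ring

theorem sum_levelWeight {K τ : ℕ} (hτ : 0 < τ) (i a : Fin K) : ∑ k, levelWeight τ i a k = 1 := by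
  have h := sum_noiseWeight_armLevel hτ i a fun _ => 1
  simp only [mul_one, sum_noiseWeight] at h
  exact h.symm

variable {K : ℕ} [NeZero K] {τ : ℕ}

/-- The adversary that raises the level of the arm `i` at random. -/
noncomputable def noisyEnv (i : Fin K) (ω : ℕ → Fin (τ + 1) × Bool) : (lockedMDP K).Env :=
  fun t => lockedRound τ t fun a => level (armLevel i a (ω (τ * (t / τ))))

theorem noisyEnv_mem (i : Fin K) (ω : ℕ → Fin (τ + 1) × Bool) :
    noisyEnv i ω ∈ lockedFamily K τ := by
  refine ⟨_, fun t a b => ?_, rfl⟩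
  set z := ω (τ * (t / τ))
  have h : ((armLevel i a z : ℕ) : ℝ) ≤ (armLevel i b z : ℕ) + 1 := by
    have : (armLevel i a z : ℕ) ≤ (armLevel i b z : ℕ) + 1 := by
      have hz : (raise z.1 : ℕ) = min τ (z.1 + 1) := rfl
      simp only [armLevel]
      split_ifs <;> omega
    exact_mod_cast this
  change ((armLevel i a z : ℕ) : ℝ) / τ - (armLevel i b z : ℕ) / τ ≤ 1 / τ
  rw [← sub_div]
  exact div_le_div_of_nonneg_right (by linarith) (Nat.cast_nonneg _)

/-- Bandit feedback never shows two arms in the same round, so the coupling between arms is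
invisible and only the law of the used arm's level matters. The true records may thus be replaced by
records `h'` with the same feedback. The level `k` is constrained only inside a block, since a
multiple of `τ` draws a new one. -/
theorem iterAvg_noisyEnv (hτ : 0 < τ) {A : (lockedMDP K).Player} (hA : UsesBanditFeedback A)
    (i : Fin K) (n t : ℕ) (h h' : List (lockedMDP K).Play)
    (hh : h.map Play.toBandit = h'.map Play.toBandit) (s : Fin K) (k : Fin (τ + 1))
    (ω : ℕ → Fin (τ + 1) × Bool) (hk : ¬ τ ∣ t → k = armLevel i s (ω (τ * (t / τ)))) :
    iterAvg (noiseWeight τ) n t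
        (fun ω => (lockedMDP K).expectedReward (noisyEnv i ω) A n t h s) ω =
      levelValue A (levelWeight τ i) (fun _ _ _ k => level k) n t h' s k := by
  induction n generalizing t h h' s k ω with
  | zero => rfl
  | succ n ih =>
    have he : ∀ (ω ω' : ℕ → Fin (τ + 1) × Bool) t, (∀ u ≤ t, ω u = ω' u) →
        noisyEnv i ω t = noisyEnv i ω' t := fun ω ω' t hω => by
      simp only [noisyEnv, hω _ (Nat.mul_div_le t τ)]
    have hnext : ¬ τ ∣ t + 1 → τ * ((t + 1) / τ) = τ * (t / τ) := fun h => by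
      rw [Nat.succ_div_of_not_dvd h]
    rw [iterAvg_expectedReward_succ (sum_noiseWeight τ) _ he, hA h h' hh]
    by_cases ht : τ ∣ t
    · have htt : τ * (t / τ) = t := Nat.mul_div_cancel' ht
      rw [levelValue_succ_of_dvd ht]
      simp only [Finset.mul_sum]
      rw [Finset.sum_comm]
      refine Finset.sum_congr rfl fun x _ => ?_
      rw [← Finset.mul_sum, ← sum_noiseWeight_armLevel hτ i x.1 fun k' => (level k' : ℝ) +
        levelValue A (levelWeight τ i) (fun _ _ _ k => (level k : ℝ)) n (t + 1)
          (⟨s, x, lockedRound τ t fun _ => level k'⟩ :: h') x.1 k', Finset.mul_sum]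
      refine Finset.sum_congr rfl fun z _ => ?_
      have hz : noisyEnv i (Function.update ω t z) t =
          lockedRound τ t fun a => level (armLevel i a z) := by
        simp only [noisyEnv, htt, Function.update_self]
      have harm : lockedArm τ t s x.1 = x.1 := if_pos ht
      rw [hz, mul_left_comm]
      simp only [lockedRound, harm]
      congr 3
      refine ih (t + 1) _ _ ?_ _ _ _ fun h₁ => ?_
      · simp [hh, Play.toBandit, harm]
      · rw [hnext h₁, htt, Function.update_self]
    · have hlt : τ * (t / τ) ≠ t := fun h => ht (h ▸ dvd_mul_right _ _)
      rw [levelValue_succ_of_not_dvd ht]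
      have harm : ∀ x, lockedArm τ t s x = s := fun x => if_neg ht
      have hz : ∀ z, noisyEnv i (Function.update ω t z) t =
          lockedRound τ t fun a => level (armLevel i a (ω (τ * (t / τ)))) := fun z => by
        simp only [noisyEnv, Function.update_of_ne hlt]
      trans ∑ z, noiseWeight τ z * ∑ x : (lockedMDP K).Act s, (A h' s x).toReal * ((level k : ℝ) +
        levelValue A (levelWeight τ i) (fun _ _ _ k => (level k : ℝ)) n (t + 1)
          (⟨s, x, lockedRound τ t fun _ => level k⟩ :: h') s k)
      swap
      · rw [← Finset.sum_mul, sum_noiseWeight, one_mul]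
      refine Finset.sum_congr rfl fun z _ => ?_
      congr 1
      refine Finset.sum_congr rfl fun x _ => ?_
      rw [hz, hk ht]
      simp only [lockedRound, harm]
      congr 2
      refine ih (t + 1) _ _ ?_ _ _ _ fun h₁ => ?_
      · simp [hh, Play.toBandit, harm]
      · rw [hnext h₁, Function.update_of_ne hlt]

theorem sum_range_id_cast (n : ℕ) : ∑ k ∈ Finset.range (n + 1), (k : ℝ) = n * (n + 1) / 2 := by
  induction n with
  | zero => simp
  | succ n ih => rw [Finset.sum_range_succ, ih]; push_cast; ring

theorem sum_range_sq_cast (n : ℕ) :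
    ∑ k ∈ Finset.range (n + 1), (k : ℝ) ^ 2 = n * (n + 1) * (2 * n + 1) / 6 := by
  induction n with
  | zero => simp
  | succ n ih => rw [Finset.sum_range_succ, ih]; push_cast; ring

/-- The mean reward of the other arms. -/
noncomputable def meanLevel (τ : ℕ) : ℝ := ∑ k : Fin (τ + 1), 1 / ((τ : ℝ) + 1) * (level k : ℝ)

/-- The gap is the mean of `shiftProb` divided by `τ`: the average of `(τ - k) (k + 1)` is `τ (τ +
2) / 6`. -/
theorem sum_levelWeight_level {K τ : ℕ} (hτ : 0 < τ) (i a : Fin K) :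
    ∑ k, levelWeight τ i a k * (level k : ℝ) =
      meanLevel τ + (τ + 2) / (96 * τ ^ 2) * if a = i then 1 else 0 := by
  have h₀ : (0 : ℝ) < τ := by exact_mod_cast hτ
  by_cases ha : a = i
  · have h₁ : ∀ k : Fin (τ + 1), levelWeight τ i a k * (level k : ℝ) =
        1 / ((τ : ℝ) + 1) * (level k : ℝ) + 1 / ((τ : ℝ) + 1) / (16 * τ ^ 3) *
          (2 * ((k : ℕ) : ℝ) ^ 2 - τ * (k : ℕ)) := fun k => by
      simp only [levelWeight, level, levelRatio, ha, if_true]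
      field_simp
      ring
    simp only [h₁, Finset.sum_add_distrib, ← Finset.mul_sum, meanLevel, Finset.sum_sub_distrib]
    rw [Fin.sum_univ_eq_sum_range (fun k => (k : ℝ) ^ 2),
      Fin.sum_univ_eq_sum_range (fun k => (k : ℝ)), sum_range_id_cast, sum_range_sq_cast]
    simp only [ha, if_true]
    field_simp
    ring
  · simp [levelWeight, ha, meanLevel]

theorem levelRatio_ge_half (hτ : 0 < τ) (k : Fin (τ + 1)) : 1 / 2 ≤ levelRatio τ (k : ℕ) := by
  have h₁ := (abs_le.1 (abs_one_sub_levelRatio_le hτ (Nat.cast_nonneg (k : ℕ))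
    (by exact_mod_cast Nat.le_of_lt_succ k.2))).2
  have h₂ : (1 : ℝ) ≤ τ := by exact_mod_cast hτ
  have h₃ : 1 / (16 * (τ : ℝ)) ≤ 1 / 2 := by
    apply one_div_le_one_div_of_le <;> linarith
  rw [levelRatio]
  linarith

/-- With `y` the deviation of the density from `1`, `-log (1 - y) ≤ y + 2 y²`; the linear terms
cancel by symmetry, and `y² ≤ 1 / (256 τ²)`. -/
theorem neg_sum_log_levelRatio_le (hτ : 0 < τ) :
    -∑ k : Fin (τ + 1), 1 / ((τ : ℝ) + 1) * Real.log (levelRatio τ (k : ℕ)) ≤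
      1 / (128 * τ ^ 2) := by
  have h₀ : (0 : ℝ) < τ := by exact_mod_cast hτ
  have h₁ : ∀ k : Fin (τ + 1), -Real.log (levelRatio τ (k : ℕ)) ≤
      (τ - 2 * (k : ℕ)) / (16 * τ ^ 2) + 1 / (128 * τ ^ 2) := fun k => by
    have hr := levelRatio_ge_half hτ k
    have hy := abs_one_sub_levelRatio_le hτ (Nat.cast_nonneg (k : ℕ))
      (by exact_mod_cast Nat.le_of_lt_succ k.2)
    have hlog := Real.one_sub_inv_le_log_of_pos (by linarith : 0 < levelRatio τ (k : ℕ))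
    rw [levelRatio] at *
    set y := ((τ : ℝ) - 2 * (k : ℕ)) / (16 * τ ^ 2)
    have hsq : y ^ 2 ≤ 1 / (256 * τ ^ 2) := by
      have := pow_le_pow_left₀ (abs_nonneg y) hy 2
      rw [sq_abs] at this
      refine this.trans (le_of_eq ?_)
      field_simp
      norm_num
    have hinv : (1 - y)⁻¹ ≤ 1 + y + 2 * y ^ 2 := by
      rw [inv_le_iff_one_le_mul₀ (by linarith)]
      nlinarith [mul_nonneg (sq_nonneg y) (show 0 ≤ 1 - 2 * y by linarith)]
    have h₂ : 1 / (128 * (τ : ℝ) ^ 2) = 2 * (1 / (256 * τ ^ 2)) := by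
      field_simp
      norm_num
    rw [h₂]
    linarith
  have h₂ : ∑ k : Fin (τ + 1), ((τ : ℝ) - 2 * (k : ℕ)) / (16 * τ ^ 2) = 0 := by
    rw [← Finset.sum_div, Finset.sum_sub_distrib, ← Finset.mul_sum,
      Fin.sum_univ_eq_sum_range (fun k => (k : ℝ)), sum_range_id_cast]
    simp
    left
    ring
  rw [← Finset.mul_sum, ← mul_neg, ← Finset.sum_neg_distrib]
  refine (mul_le_mul_of_nonneg_left (Finset.sum_le_sum fun k _ => h₁ k) (by positivity)).trans ?_
  rw [Finset.sum_add_distrib, h₂]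
  simp
  field_simp
  norm_num

/-- Averaging over the good arm. Under uniform levels the arms share `T` rounds. With `μ = 1 / 8`,
the change of measure adds at most `K T / 8` from the initial potential and, by `T ≤ K τ³`, at most
`K T / 8` from the entropy. The sum `T + K T / 4` is at most `3 K T / 4` as `K ≥ 2`. -/
theorem exists_levelValue_le (hτ : 0 < τ) {T : ℕ} (hK : 2 ≤ K) (hτT : τ ≤ T)
    (hT : T ≤ K * τ ^ 3) (A : (lockedMDP K).Player) :
    ∃ i, levelValue A (levelWeight τ i) (armPay τ i (armRounds τ)) T 0 [] 0 0 ≤ 3 / 4 * T := by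
  by_contra! hlt
  have h₀ : (0 : ℝ) < τ := by exact_mod_cast hτ
  have hKR : (2 : ℝ) ≤ K := by exact_mod_cast hK
  have hT₀ : (0 : ℝ) < T := by exact_mod_cast hτ.trans_le hτT
  have hTK : (T : ℝ) ≤ K * τ ^ 3 := by exact_mod_cast hT
  have hτT' : (τ : ℝ) ≤ T := by exact_mod_cast hτT
  set κ : ℝ := 1 / (128 * (τ : ℝ) ^ 2) with hκ
  have hp₁ := sum_uniform τ
  have h₁ : ∀ i : Fin K, levelValue A (levelWeight τ i) (armPay τ i (armRounds τ)) T 0 [] 0 0 ≤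
      levelValue A (fun _ _ => 1 / ((τ : ℝ) + 1)) (armPay τ i (armRounds τ)) T 0 [] 0 0 +
      T * (1 / 8 + κ / (1 / 8) *
        levelValue A (fun _ _ => 1 / ((τ : ℝ) + 1)) (armPay τ i fun _ _ => 1) T 0 [] 0 0) := by
    intro i
    have hpr := sum_levelWeight hτ i i
    simp only [levelWeight, if_true] at hpr
    have := levelValue_change_of_measure (A := A) (i := i) (n := T) (t := 0) (h := []) (s := 0)
      (k := 0) (p := fun _ => 1 / ((τ : ℝ) + 1)) (r := fun k => levelRatio τ (k : ℕ)) (κ := κ)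
      (μ := 1 / 8) (ℓ := 1) (by norm_num) (fun _ => by positivity) hp₁
      (fun k => by linarith [levelRatio_ge_half hτ k]) hpr (neg_sum_log_levelRatio_le hτ)
      (by positivity) one_pos
    rw [lockedRounds_of_dvd _ (dvd_zero τ)] at this
    have hd : densityBound (1 / 8) 1 = 1 / 8 := by simp [densityBound]
    rw [hd, one_mul, Nat.cast_zero, sub_zero] at this
    change levelValue A (fun a k => 1 / ((τ : ℝ) + 1) * if a = i then levelRatio τ (k : ℕ) else 1)
      (armPay τ i (armRounds τ)) T 0 [] 0 0 ≤ _
    linarith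
  have h₂ : (K : ℝ) * (3 / 4 * T) <
      ∑ i : Fin K, levelValue A (levelWeight τ i) (armPay τ i (armRounds τ)) T 0 [] 0 0 := by
    have := Finset.sum_lt_sum_of_nonempty (Finset.univ_nonempty (α := Fin K)) fun i _ => hlt i
    simpa using this
  have h₃ := h₂.trans_le (Finset.sum_le_sum fun i _ => h₁ i)
  rw [Finset.sum_add_distrib, ← Finset.mul_sum, Finset.sum_add_distrib, ← Finset.mul_sum,
    sum_levelValue_armRounds (fun _ => hp₁), lockedRounds_of_dvd _ (dvd_zero τ)] at h₃
  have h₄ : κ / (1 / 8) * ∑ i : Fin K,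
      levelValue A (fun _ _ => 1 / ((τ : ℝ) + 1)) (armPay τ i fun _ _ => 1) T 0 [] 0 0 ≤ K / 8 := by
    refine (mul_le_mul_of_nonneg_left (sum_levelValue_one fun _ => hp₁) (by positivity)).trans ?_
    have h₅ : (T : ℝ) / τ + 1 ≤ 2 * T / τ := by
      rw [div_add_one h₀.ne']
      exact div_le_div_of_nonneg_right (by linarith) h₀.le
    refine (mul_le_mul_of_nonneg_left h₅ (by positivity)).trans ?_
    rw [hκ, show 1 / (128 * (τ : ℝ) ^ 2) / (1 / 8) * (2 * T / τ) = T / τ ^ 3 / 8 by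
      field_simp; norm_num]
    have : (T : ℝ) / τ ^ 3 ≤ K := (div_le_iff₀ (by positivity)).2 hTK
    linarith
  have h₅ := mul_le_mul_of_nonneg_left h₄ hT₀.le
  simp only [Finset.sum_const, Finset.card_univ, Fintype.card_fin, nsmul_eq_mul, Nat.cast_zero,
    sub_zero] at h₃
  nlinarith

/-- The mean regret against the good arm is the gap, at least `1 / (96 τ)`, times the expected
number of rounds off that arm, at least `T / 4`. -/
theorem exists_le_regret_of_bandit (hτ : 0 < τ) {T : ℕ} (hK : 2 ≤ K) (hτT : τ ≤ T)
    (hT : T ≤ K * τ ^ 3) {A : (lockedMDP K).Player} (hA : UsesBanditFeedback A) :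
    ∃ e ∈ lockedFamily K τ, (T : ℝ) / (384 * τ) ≤
      (lockedMDP K).regret (constPolicies K) constPolicies_nonempty T e A := by
  obtain ⟨i, hi⟩ := exists_levelValue_le hτ hK hτT hT A
  have h₀ : (0 : ℝ) < τ := by exact_mod_cast hτ
  obtain ⟨ω, hω⟩ := exists_iterAvg_le (noiseWeight_nonneg hτ) (sum_noiseWeight τ) T 0
    (fun ω => ∑ t ∈ Finset.range T, (level (armLevel i i (ω (τ * (t / τ)))) : ℝ) +
      (-1) * (lockedMDP K).expectedReward (noisyEnv i ω) A T 0 [] 0) fun _ => (0, false)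
  refine ⟨noisyEnv i ω, noisyEnv_mem i ω, le_trans (le_trans ?_ hω) (le_trans (le_of_eq ?_)
    (le_regret τ T (fun t a => level (armLevel i a (ω (τ * (t / τ))))) A i))⟩
  · rw [iterAvg_add, iterAvg_const_mul, iterAvg_sum, iterAvg_noisyEnv hτ hA i T 0 [] [] rfl 0 0 _
        (fun h => absurd (dvd_zero τ) h), levelValue_reward (sum_levelWeight hτ i)
        (sum_levelWeight_level hτ i), lockedRounds_of_dvd _ (dvd_zero τ)]
    have h₁ : ∀ t ∈ Finset.range T, iterAvg (noiseWeight τ) T 0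
        (fun ω => (level (armLevel i i (ω (τ * (t / τ)))) : ℝ)) (fun _ => (0, false)) =
        meanLevel τ + (τ + 2) / (96 * τ ^ 2) := fun t ht => by
      rw [iterAvg_apply (sum_noiseWeight τ) T 0 (τ * (t / τ)) (Nat.zero_le _)
        (by rw [zero_add]; exact (Nat.mul_div_le t τ).trans_lt (Finset.mem_range.1 ht))
        (fun z => (level (armLevel i i z) : ℝ)),
        sum_noiseWeight_armLevel hτ i i (fun k => (level k : ℝ)), sum_levelWeight_level hτ]
      simp
    rw [Finset.sum_congr rfl h₁]
    simp only [Finset.sum_const, Finset.card_range, nsmul_eq_mul, Nat.cast_zero]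
    have h₂ : 1 / (96 * (τ : ℝ)) ≤ (τ + 2) / (96 * τ ^ 2) := by
      rw [div_le_div_iff₀ (by positivity) (by positivity)]
      nlinarith
    have h₃ : (T : ℝ) / (384 * τ) = 1 / (96 * τ) * (T / 4) := by
      field_simp
      ring
    have h₄ := mul_le_mul_of_nonneg_left hi
      (show (0 : ℝ) ≤ (τ + 2) / (96 * τ ^ 2) by positivity)
    have h₅ := mul_le_mul_of_nonneg_right h₂ (show (0 : ℝ) ≤ T / 4 by positivity)
    rw [h₃]
    nlinarith
  · rw [neg_one_mul, ← sub_eq_add_neg]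
    rfl

end NoisyArms

/-! ### Fair coins and the full-information lower bound -/

section FairCoins

/-- The sign of a coin. -/
def coinSign (b : Bool) : ℝ := if b then 1 else -1

/-- The offset `a` absorbs the coins already tossed, which lets the moment computations run by
induction. -/
theorem iterAvg_coinSum_succ (g : ℝ → ℝ) (c : ℕ → ℝ) (a : ℝ) (n t : ℕ) (ω : ℕ → Bool) :
    iterAvg (fun _ : Bool => (1 / 2 : ℝ)) (n + 1) t
        (fun ω => g (a + ∑ u ∈ Finset.Ico t (t + (n + 1)), c u * coinSign (ω u))) ω =
      ∑ z : Bool, 1 / 2 * iterAvg (fun _ : Bool => (1 / 2 : ℝ)) n (t + 1)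
        (fun ω => g (a + c t * coinSign z + ∑ u ∈ Finset.Ico (t + 1) (t + 1 + n),
          c u * coinSign (ω u))) (Function.update ω t z) := by
  refine Finset.sum_congr rfl fun z _ => congrArg _ (iterAvg_congr _ _ _ fun ω' hω' => ?_)
  rw [Finset.sum_eq_sum_Ico_succ_bot (by omega), hω' t (by omega), Function.update_self, add_assoc,
    show t + (n + 1) = t + 1 + n by ring]

theorem iterAvg_coinSum_sq (c : ℕ → ℝ) (a : ℝ) (n t : ℕ) (ω : ℕ → Bool) :
    iterAvg (fun _ : Bool => (1 / 2 : ℝ)) n t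
        (fun ω => (a + ∑ u ∈ Finset.Ico t (t + n), c u * coinSign (ω u)) ^ 2) ω =
      a ^ 2 + ∑ u ∈ Finset.Ico t (t + n), c u ^ 2 := by
  induction n generalizing t a ω with
  | zero => simp [iterAvg]
  | succ n ih =>
    rw [iterAvg_coinSum_succ fun x => x ^ 2, Finset.sum_eq_sum_Ico_succ_bot (by omega)]
    rw [Fintype.sum_bool, ih, ih]
    simp only [coinSign, if_true, Bool.false_eq_true, if_false]
    rw [show t + (n + 1) = t + 1 + n by ring]
    ring

theorem iterAvg_coinSum_pow_four_le (c : ℕ → ℝ) (a : ℝ) (n t : ℕ) (ω : ℕ → Bool) :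
    iterAvg (fun _ : Bool => (1 / 2 : ℝ)) n t
        (fun ω => (a + ∑ u ∈ Finset.Ico t (t + n), c u * coinSign (ω u)) ^ 4) ω ≤
      a ^ 4 + 6 * a ^ 2 * ∑ u ∈ Finset.Ico t (t + n), c u ^ 2 +
        3 * (∑ u ∈ Finset.Ico t (t + n), c u ^ 2) ^ 2 := by
  induction n generalizing t a ω with
  | zero => simp [iterAvg]
  | succ n ih =>
    rw [iterAvg_coinSum_succ fun x => x ^ 4, Finset.sum_eq_sum_Ico_succ_bot (by omega)]
    have h₁ := ih (a + c t * coinSign true) (t + 1) (Function.update ω t true)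
    have h₂ := ih (a + c t * coinSign false) (t + 1) (Function.update ω t false)
    rw [show t + (n + 1) = t + 1 + n by ring, Fintype.sum_bool]
    simp only [coinSign, if_true, Bool.false_eq_true, if_false] at h₁ h₂ ⊢
    nlinarith [sq_nonneg (c t ^ 2)]

/-- Khinchine's inequality. -/
theorem le_iterAvg_abs_coinSum (c : ℕ → ℝ) (n t : ℕ) (ω : ℕ → Bool) :
    5 / 9 * Real.sqrt (∑ u ∈ Finset.Ico t (t + n), c u ^ 2) ≤
      iterAvg (fun _ : Bool => (1 / 2 : ℝ)) n t
        (fun ω => |∑ u ∈ Finset.Ico t (t + n), c u * coinSign (ω u)|) ω := by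
  set C := ∑ u ∈ Finset.Ico t (t + n), c u ^ 2 with hC
  have hC₀ : 0 ≤ C := Finset.sum_nonneg fun _ _ => sq_nonneg _
  set s := Real.sqrt C with hs
  have hsq : s ^ 2 = C := Real.sq_sqrt hC₀
  rcases (Real.sqrt_nonneg C).eq_or_lt with h₀ | h₀
  · rw [hs, ← h₀, mul_zero]
    refine le_of_eq_of_le (iterAvg_const (by norm_num) n t 0 ω).symm
      (iterAvg_mono (fun _ => by norm_num) n t (fun _ => abs_nonneg _) ω)
  · have h₂ := iterAvg_coinSum_sq c 0 n t ω
    have h₄ := iterAvg_coinSum_pow_four_le c 0 n t ω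
    simp only [zero_add, ← hC] at h₂ h₄
    -- The quartic minorant `27 s² x² - 4 x⁴` of `27 s³ |x|` touches it at `|x| = 3 s / 2`. The
    -- moment bounds leave `(27 - 12) s⁴`, whence `5 / 9 = 15 / 27`.
    have h := iterAvg_mono (P := fun _ : Bool => (1 / 2 : ℝ)) (fun _ => by norm_num) n t
      (F := fun ω => 27 * s ^ 2 * (∑ u ∈ Finset.Ico t (t + n), c u * coinSign (ω u)) ^ 2 +
        (-4) * (∑ u ∈ Finset.Ico t (t + n), c u * coinSign (ω u)) ^ 4)
      (G := fun ω => 27 * s ^ 3 * |∑ u ∈ Finset.Ico t (t + n), c u * coinSign (ω u)|)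
      (fun ω => by
        set x := ∑ u ∈ Finset.Ico t (t + n), c u * coinSign (ω u)
        rw [← sq_abs x, show x ^ 4 = |x| ^ 4 by rw [← Even.pow_abs (by decide)]]
        have hx := abs_nonneg x
        have : 27 * s ^ 3 * |x| - (27 * s ^ 2 * |x| ^ 2 + (-4) * |x| ^ 4) =
          |x| * ((|x| + 3 * s) * (2 * |x| - 3 * s) ^ 2) := by ring
        have : 0 ≤ |x| * ((|x| + 3 * s) * (2 * |x| - 3 * s) ^ 2) := by positivity
        linarith) ω
    rw [iterAvg_add, iterAvg_const_mul, iterAvg_const_mul, iterAvg_const_mul, h₂] at h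
    have h₅ : 27 * s ^ 3 * (5 / 9 * s) ≤ 27 * s ^ 3 * iterAvg (fun _ : Bool => (1 / 2 : ℝ)) n t
        (fun ω => |∑ u ∈ Finset.Ico t (t + n), c u * coinSign (ω u)|) ω := by
      refine le_trans ?_ h
      rw [← hsq] at h₄ ⊢
      nlinarith
    exact le_of_mul_le_mul_left h₅ (by positivity)

variable {K : ℕ} [NeZero K] {m : ℕ} [NeZero m]

/-- The adversary that tosses a coin in each round and rewards the arms whose bit with index
`t mod m` predicts it. -/
def coinEnv (φ : Fin K → Fin m → Bool) (ω : ℕ → Bool) : (lockedMDP K).Env :=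
  fun t => lockedRound 1 t fun a => if φ a (Fin.ofNat m t) = ω t then 1 else 0

theorem coinEnv_mem (φ : Fin K → Fin m → Bool) (ω : ℕ → Bool) :
    coinEnv φ ω ∈ lockedFamily K 1 :=
  ⟨_, fun t a b => by
    have h₁ := (if φ a (Fin.ofNat m t) = ω t then (1 : Set.Icc (0 : ℝ) 1) else 0).2
    have h₂ := (if φ b (Fin.ofNat m t) = ω t then (1 : Set.Icc (0 : ℝ) 1) else 0).2
    simp only [Nat.cast_one, div_one]
    linarith [h₁.2, h₂.1], rfl⟩

/-- The coin of a round is independent of the past and of the action, so any prediction is right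
with probability `1 / 2`. -/
theorem iterAvg_coinEnv (φ : Fin K → Fin m → Bool) (A : (lockedMDP K).Player) (n t : ℕ)
    (h : List (lockedMDP K).Play) (s : Fin K) (ω : ℕ → Bool) :
    iterAvg (fun _ : Bool => (1 / 2 : ℝ)) n t
      (fun ω => (lockedMDP K).expectedReward (coinEnv φ ω) A n t h s) ω = n / 2 := by
  induction n generalizing t h s ω with
  | zero => simp [iterAvg, expectedReward]
  | succ n ih =>
    rw [iterAvg_expectedReward_succ (by norm_num) _ fun ω ω' t hω => by
      simp only [coinEnv, hω t le_rfl]]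
    simp only [ih, mul_add, Finset.sum_add_distrib, sum_act_const]
    rw [← Finset.mul_sum, Finset.sum_comm]
    have h₁ : ∀ x : (lockedMDP K).Act s, ∑ z : Bool, (A h s x).toReal *
        (coinEnv φ (Function.update ω t z) t).reward s x = (A h s x).toReal * 1 := fun x => by
      rw [← Finset.mul_sum]
      congr 1
      simp only [coinEnv, lockedRound, Function.update_self, Fintype.sum_bool]
      cases φ (lockedArm 1 t s x.1) (Fin.ofNat m t) <;> simp
    rw [Finset.sum_congr rfl fun x _ => h₁ x, sum_act_const]
    simp
    ring

/-- The sum of the signs of the coins of the rounds `t < T` that are congruent to `j`. -/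
noncomputable def coinSum (T : ℕ) (j : Fin m) (ω : ℕ → Bool) : ℝ :=
  ∑ t ∈ Finset.Ico 0 (0 + T), (if Fin.ofNat m t = j then 1 else 0) * coinSign (ω t)

/-- The arm whose bits are the majority outcomes of the residue classes. -/
theorem exists_sum_coin_eq {K : ℕ} {φ : Fin K → Fin m → Bool} (hφ : Function.Surjective φ) (T : ℕ)
    (ω : ℕ → Bool) :
    ∃ i, ∑ t ∈ Finset.range T,
        ((if φ i (Fin.ofNat m t) = ω t then 1 else 0 : Set.Icc (0 : ℝ) 1) : ℝ) =
      T / 2 + 1 / 2 * ∑ j : Fin m, |coinSum T j ω| := by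
  obtain ⟨i, hi⟩ := hφ fun j => decide (0 ≤ coinSum T j ω)
  refine ⟨i, ?_⟩
  have h₁ : ∀ j : Fin m, |coinSum T j ω| = coinSign (φ i j) * coinSum T j ω := fun j => by
    rw [hi]
    by_cases h : 0 ≤ coinSum T j ω
    · simp [coinSign, h, abs_of_nonneg h]
    · simp [coinSign, h, abs_of_neg (not_le.1 h)]
  simp only [h₁]
  simp only [coinSum, Finset.mul_sum]
  rw [Finset.sum_comm]
  simp only [zero_add, Nat.Ico_zero_eq_range]
  have h₂ : (T : ℝ) / 2 = ∑ t ∈ Finset.range T, (1 / 2 : ℝ) := by simp; ring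
  rw [h₂, ← Finset.sum_add_distrib]
  refine Finset.sum_congr rfl fun t _ => ?_
  have h₃ : ∀ j : Fin m, 1 / 2 * (coinSign (φ i j) *
      ((if Fin.ofNat m t = j then 1 else 0) * coinSign (ω t))) =
      if Fin.ofNat m t = j then 1 / 2 * (coinSign (φ i j) * coinSign (ω t)) else 0 := fun j => by
    split_ifs <;> ring
  simp only [h₃, Finset.sum_ite_eq, Finset.mem_univ, if_true]
  cases φ i (Fin.ofNat m t) <;> cases ω t <;> norm_num [coinSign]

/-- A class has at least `⌊T / m⌋` rounds; as `m ≤ T`, rounding down loses at most a factor `2`. -/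
theorem div_le_sum_residue {T : ℕ} (hm : m ≤ T) (j : Fin m) :
    (T : ℝ) / (2 * m) ≤
      ∑ t ∈ Finset.Ico 0 (0 + T), (if Fin.ofNat m t = j then (1 : ℝ) else 0) ^ 2 := by
  have hm₀ : 0 < m := Nat.pos_of_ne_zero (NeZero.ne m)
  have h₁ : T / m ≤ ((Finset.range T).filter fun t => Fin.ofNat m t = j).card := by
    have h₂ := Nat.count_modEq_card T hm₀ j.1
    rw [Nat.count_eq_card_filter_range] at h₂
    have h₃ : ∀ t, Fin.ofNat m t = j ↔ t ≡ j.1 [MOD m] := fun t => by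
      rw [Fin.ext_iff, Nat.ModEq, Nat.mod_eq_of_lt j.2]
      rfl
    simp only [h₃]
    rw [h₂]
    exact Nat.le_add_right _ _
  have h₂ : (T : ℝ) ≤ (T / m : ℕ) * (2 * m) := by
    have h₃ := Nat.div_add_mod T m
    have h₄ := Nat.mod_lt T hm₀
    have h₅ := Nat.div_pos hm hm₀
    have : T ≤ T / m * (2 * m) := by nlinarith
    exact_mod_cast this
  simp only [zero_add, Nat.Ico_zero_eq_range, ite_pow, one_pow, ne_eq, OfNat.ofNat_ne_zero,
    not_false_eq_true, zero_pow, Finset.sum_boole]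
  refine le_trans ?_ (Nat.cast_le.2 h₁)
  rw [div_le_iff₀ (by positivity)]
  exact h₂

theorem exists_le_regret_of_bits (hK : 2 ^ m ≤ K) {T : ℕ} (hm : m ≤ T)
    (A : (lockedMDP K).Player) :
    ∃ e ∈ lockedFamily K 1, 5 / 18 * m * Real.sqrt (T / (2 * m)) ≤
      (lockedMDP K).regret (constPolicies K) constPolicies_nonempty T e A := by
  obtain ⟨φ, hφ⟩ : ∃ φ : Fin K → Fin m → Bool, Function.Surjective φ := by
    obtain ⟨f⟩ : Nonempty ((Fin m → Bool) ↪ Fin K) :=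
      Function.Embedding.nonempty_of_card_le (by simpa using hK)
    exact ⟨Function.invFun f, Function.invFun_surjective f.injective⟩
  obtain ⟨ω, hω⟩ := exists_iterAvg_le (P := fun _ : Bool => (1 / 2 : ℝ)) (fun _ => by norm_num)
    (by norm_num) T 0 (fun ω => T / 2 + (1 / 2 * ∑ j : Fin m, |coinSum T j ω| +
      (-1) * (lockedMDP K).expectedReward (coinEnv φ ω) A T 0 [] 0)) fun _ => false
  obtain ⟨i, hi⟩ := exists_sum_coin_eq hφ T ω
  refine ⟨coinEnv φ ω, coinEnv_mem φ ω, le_trans (le_trans ?_ hω) (le_trans (le_of_eq ?_)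
    (le_regret 1 T (fun t a => if φ a (Fin.ofNat m t) = ω t then 1 else 0) A i))⟩
  · rw [iterAvg_add, iterAvg_add, iterAvg_const_mul, iterAvg_const_mul, iterAvg_coinEnv,
      iterAvg_const (by norm_num), iterAvg_sum]
    have h₁ : ∀ j : Fin m, 5 / 9 * Real.sqrt (T / (2 * m)) ≤
        iterAvg (fun _ : Bool => (1 / 2 : ℝ)) T 0 (fun ω => |coinSum T j ω|) fun _ => false :=
      fun j => (mul_le_mul_of_nonneg_left (Real.sqrt_le_sqrt (div_le_sum_residue hm j))
        (by norm_num)).trans (le_iterAvg_abs_coinSum _ T 0 _)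
    have h₂ := Finset.sum_le_sum fun j (_ : j ∈ Finset.univ) => h₁ j
    simp only [Finset.sum_const, Finset.card_univ, Fintype.card_fin, nsmul_eq_mul] at h₂
    linarith
  · rw [hi, neg_one_mul, ← add_assoc, ← sub_eq_add_neg]
    rfl

end FairCoins

/-! ### Choice of the parameters -/

theorem exists_le_regret_of_log_le {K T : ℕ} [NeZero K] (hK : 2 ≤ K) (hT : Real.log K ≤ T)
    (A : (lockedMDP K).Player) :
    ∃ e ∈ lockedFamily K 1, 1 / 768 * Real.sqrt (T * Real.log K) ≤
      (lockedMDP K).regret (constPolicies K) constPolicies_nonempty T e A := by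
  have hlog : 0 < Real.log K := Real.log_pos (by exact_mod_cast hK)
  have hT₀ : 0 < T := by exact_mod_cast hlog.trans_le hT
  have hl : 0 < Nat.log 2 K := Nat.log_pos (by norm_num) hK
  have hm : 0 < min (Nat.log 2 K) T := lt_min hl hT₀
  have : NeZero (min (Nat.log 2 K) T) := ⟨hm.ne'⟩
  obtain ⟨e, he, hreg⟩ := exists_le_regret_of_bits (m := min (Nat.log 2 K) T)
    ((Nat.pow_le_pow_right (by norm_num) (min_le_left _ _)).trans
      (Nat.pow_log_le_self 2 (by omega))) (min_le_right _ T) A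
  refine ⟨e, he, le_trans ?_ hreg⟩
  -- If the minimum is `l = Nat.log 2 K`, then `log K ≤ (l + 1) log 2 ≤ 2 l`; if it is `T`, the
  -- hypothesis `hT` suffices.
  have hlogm : Real.log K ≤ 2 * (min (Nat.log 2 K) T : ℕ) := by
    rcases min_choice (Nat.log 2 K) T with h | h <;> rw [h]
    · have h₁ : (K : ℝ) ≤ 2 ^ (Nat.log 2 K + 1) := by
        exact_mod_cast (Nat.lt_pow_succ_log_self (by norm_num) K).le
      have h₂ := Real.log_le_log (by positivity) h₁
      rw [Real.log_pow] at h₂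
      have h₃ : (1 : ℝ) ≤ Nat.log 2 K := by exact_mod_cast hl
      have h₄ := Real.log_two_lt_d9
      push_cast at h₂
      nlinarith
    · have : (0 : ℝ) ≤ T := Nat.cast_nonneg _
      linarith
  set m := min (Nat.log 2 K) T
  have hm₀ : (0 : ℝ) < m := by exact_mod_cast hm
  have h₁ : Real.sqrt (T * Real.log K) ≤ 2 * m * Real.sqrt (T / (2 * m)) := by
    rw [← Real.sqrt_sq (by positivity : (0 : ℝ) ≤ 2 * m), ← Real.sqrt_mul (by positivity),
      Real.sqrt_sq (by positivity)]
    refine Real.sqrt_le_sqrt ?_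
    rw [show (2 * (m : ℝ)) ^ 2 * (T / (2 * m)) = T * (2 * m) by field_simp]
    exact mul_le_mul_of_nonneg_left hlogm (Nat.cast_nonneg _)
  -- The bound holds even with `5 / 36`; the smaller `1 / 768` is the constant of the bandit case.
  have h₂ : 0 ≤ (m : ℝ) * Real.sqrt (T / (2 * m)) := by positivity
  linarith

theorem exists_period {K T : ℕ} (hK : 2 ≤ K) (hT : K ≤ T) :
    ∃ τ : ℕ, 0 < τ ∧ τ ≤ T ∧ T ≤ K * τ ^ 3 ∧
      1 / 768 * ((K : ℝ) ^ (1 / 3 : ℝ) * (T : ℝ) ^ (2 / 3 : ℝ)) ≤ (T : ℝ) / (384 * τ) := by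
  have hK₀ : (0 : ℝ) < K := by exact_mod_cast (by omega : 0 < K)
  have hT₀ : (0 : ℝ) < T := by exact_mod_cast (by omega : 0 < T)
  have hT₁ : (1 : ℝ) ≤ T := by exact_mod_cast (by omega : 1 ≤ T)
  have hKT : (K : ℝ) ≤ T := by exact_mod_cast hT
  set k := (K : ℝ) ^ (1 / 3 : ℝ) with hk
  set r := (T : ℝ) ^ (1 / 3 : ℝ) with hr
  have hk₀ : 0 < k := Real.rpow_pos_of_pos hK₀ _
  have hr₀ : 0 < r := Real.rpow_pos_of_pos hT₀ _
  have hk₁ : 1 ≤ k := Real.one_le_rpow (by exact_mod_cast (by omega : 1 ≤ K)) (by norm_num)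
  have hk₃ : k ^ 3 = K := by rw [hk, ← Real.rpow_natCast, ← Real.rpow_mul hK₀.le]; norm_num
  have hr₃ : r ^ 3 = T := by rw [hr, ← Real.rpow_natCast, ← Real.rpow_mul hT₀.le]; norm_num
  have hr₂ : (T : ℝ) ^ (2 / 3 : ℝ) = r ^ 2 := by
    rw [hr, ← Real.rpow_natCast, ← Real.rpow_mul hT₀.le]; norm_num
  have hkr : k ≤ r := Real.rpow_le_rpow hK₀.le hKT (by norm_num)
  have h₁ : 1 ≤ r / k := (one_le_div hk₀).2 hkr
  have hceil := Nat.ceil_lt_add_one (zero_le_one.trans h₁)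
  have hle := Nat.le_ceil (r / k)
  -- The smallest period with `T ≤ K τ ^ 3`. Since `r / k ≥ 1`, rounding up at most doubles it,
  -- which turns `384` into `768`.
  set τ := ⌈r / k⌉₊ with hτ
  have hτ₀ : 0 < τ := Nat.ceil_pos.2 (by positivity)
  have hτ₀' : (0 : ℝ) < τ := by exact_mod_cast hτ₀
  refine ⟨τ, hτ₀, Nat.ceil_le.2 ?_, ?_, ?_⟩
  · have hr₁ := hk₁.trans hkr
    calc r / k ≤ r := div_le_self hr₀.le hk₁
      _ ≤ r ^ 3 := le_self_pow₀ hr₁ (by norm_num)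
      _ = T := hr₃
  · have h₂ : r ≤ k * τ := by rw [mul_comm]; exact (div_le_iff₀ hk₀).1 hle
    have h₃ : (T : ℝ) ≤ K * τ ^ 3 := by
      rw [← hr₃, ← hk₃, ← mul_pow]
      exact pow_le_pow_left₀ hr₀.le h₂ 3
    exact_mod_cast h₃
  · have h₂ : (τ : ℝ) * k ≤ 2 * r := by
      have : (τ : ℝ) ≤ 2 * (r / k) := by linarith
      calc (τ : ℝ) * k ≤ 2 * (r / k) * k := by gcongr
        _ = 2 * r := by field_simp
    rw [hr₂, ← hr₃, le_div_iff₀ (by positivity)]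
    nlinarith [mul_le_mul_of_nonneg_left h₂ (sq_nonneg r)]

end DdMDP

theorem mainTheorem11 :
    ∃ c : ℝ, 0 < c ∧
      -- full information
      (∀ K T : ℕ, 2 ≤ K → Real.log K ≤ T →
        ∃ (S X : Type) (_ : Finite S) (_ : Finite X) (M : DdMDP S X)
          (Γ : Finset M.Policy) (hΓ : Γ.Nonempty) (𝓔 : Set M.Env),
          Γ.card = K ∧ M.IsChasable Γ T 𝓔 1 ∧
          ∀ A : M.Player, ∃ e ∈ 𝓔,
            c * Real.sqrt (T * Real.log K) ≤ M.regret Γ hΓ T e A) ∧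
      -- bandit feedback
      (∀ K T : ℕ, 2 ≤ K → K ≤ T →
        ∃ (S X : Type) (_ : Finite S) (_ : Finite X) (M : DdMDP S X)
          (Γ : Finset M.Policy) (hΓ : Γ.Nonempty) (𝓔 : Set M.Env),
          Γ.card = K ∧ M.IsBanditChasable Γ T 𝓔 1 ∧
          ∀ A : M.Player, DdMDP.UsesBanditFeedback A → ∃ e ∈ 𝓔,
            c * ((K : ℝ) ^ (1 / 3 : ℝ) * (T : ℝ) ^ (2 / 3 : ℝ)) ≤ M.regret Γ hΓ T e A) := by
  refine ⟨1 / 768, by norm_num, fun K T hK hT => ?_, fun K T hK hT => ?_⟩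
  · have : NeZero K := ⟨by omega⟩
    exact ⟨Fin K, Fin K, inferInstance, inferInstance, DdMDP.lockedMDP K, DdMDP.constPolicies K,
      DdMDP.constPolicies_nonempty, DdMDP.lockedFamily K 1, DdMDP.card_constPolicies,
      ⟨_, DdMDP.locked_chasesWithin one_pos⟩, DdMDP.exists_le_regret_of_log_le hK hT⟩
  · have : NeZero K := ⟨by omega⟩
    obtain ⟨τ, hτ, hτT, hTK, hc⟩ := DdMDP.exists_period hK hT
    refine ⟨Fin K, Fin K, inferInstance, inferInstance, DdMDP.lockedMDP K, DdMDP.constPolicies K,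
      DdMDP.constPolicies_nonempty, DdMDP.lockedFamily K τ, DdMDP.card_constPolicies,
      DdMDP.locked_isBanditChasable hτ, fun A hA => ?_⟩
    obtain ⟨e, he, hreg⟩ := DdMDP.exists_le_regret_of_bandit hτ hK hτT hTK hA
    exact ⟨e, he, hc.trans hreg⟩
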